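/- For real $\varepsilon>0$ and $\lambda$ consider the equation $$\varepsilon^{2}u''=u^{3}-\lambda u+\cos t,\qquad t\in\mathbb R. \tag{1}$$ Let $u_p$ denote the $2\pi$-periodic solution of (1) with $u_p'(0)=0$, $u_p(\pi/2)=0$ and $u_p'>0$ on $(0,\pi/2)$, and let $$\lambda_b=\lambda_b(\varepsilon)=\sup\{\lambda\in\mathbb R:\ u_p \text{ exists and is the only solution of (1) with } u'(0)=u'(\pi)=0\}.$$ **Theorem.** There is $\varepsilon_0>0$ such that for every $0<\varepsilon<\varepsilon_0$ the set in the definition of $\lambda_b(\varepsilon)$ is nonempty and bounded above (so $\lambda_b(\varepsilon)$ is a real number), and for every $\lambda>\lambda_b(\varepsilon)$ equation (1) has at least five $2\pi$-periodic solutions $u_1,\dots,u_5$, all satisfying $u_i'(0)=u_i'(\pi)=0$, such that - $u_1(t)<u_2(t)<u_3(t)<u_4(t)<u_5(t)$ for all $t\in\mathbb R$; - $u_i(0)<0$ for $i=1,2,3$; - $u_3=u_p$, and $u_3$ is antisymmetric about $\pi/2$: $u_3(\pi/2+t)=-u_3(\pi/2-t)$ for all $t$; - $u_5(t)=-u_1(t+\pi)$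 and $u_4(t)=-u_2(t+\pi)$ for all $t$. In particular, for no $\lambda>\lambda_b(\varepsilon)$ is $u_p$ the only solution with $u'(0)=u'(\pi)=0$. -/

import Mathlib

/-- `u` is a (classical, globally defined) solution of the forced Duffing equation
`ε² u'' = u³ - lam * u + cos t`. -/
def IsDuffingSolution (ε lam : ℝ) (u : ℝ → ℝ) : Prop :=
  ContDiff ℝ 2 u ∧
    ∀ t : ℝ, ε ^ 2 * deriv (deriv u) t = u t ^ 3 - lam * u t + Real.cos t

/-- A solution with `u'(0) = 0` and `u'(π) = 0`.  (Every solution on `[0, π]` with these boundary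
conditions extends, by even reflection, to a global one, which is even and `2π`-periodic.) -/
def IsNeumannSolution (ε lam : ℝ) (u : ℝ → ℝ) : Prop :=
  IsDuffingSolution ε lam u ∧ deriv u 0 = 0 ∧ deriv u Real.pi = 0

/-- `u` is the distinguished solution `u_p`: the `2π`-periodic solution with `u'(0) = 0`,
`u(π/2) = 0` and `u' > 0` on `(0, π/2)`. -/
def IsUp (ε lam : ℝ) (u : ℝ → ℝ) : Prop :=
  IsDuffingSolution ε lam u ∧ Function.Periodic u (2 * Real.pi) ∧
    deriv u 0 = 0 ∧ u (Real.pi / 2) = 0 ∧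
    ∀ t ∈ Set.Ioo (0 : ℝ) (Real.pi / 2), 0 < deriv u t

/-- The set of all `lam` for which there is only one solution, namely `u_p`, with
`u'(0) = 0` and `u'(π) = 0`. -/
def uniquenessSet (ε : ℝ) : Set ℝ :=
  {lam : ℝ | ∃ p : ℝ → ℝ, IsUp ε lam p ∧ ∀ u : ℝ → ℝ, IsNeumannSolution ε lam u ↔ u = p}

/-- The bifurcation value `λ_b = λ_b(ε)`. -/
noncomputable def lambdaB (ε : ℝ) : ℝ := sSup (uniquenessSet ε)

/-! Put k = ε⁻². Solutions with u'(0) = u'(π) = 0 are the zeros of a shooting function: start at (γ,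
0) and record the velocity at π. The nonlinearity is frozen outside [-(λ+2), λ+2], which makes the
family global and Lipschitz in γ; by the maximum principle zeros of the truncated shooting function
are genuine solutions (`ShootingFamily.neumannSol`).

Sliding γ upwards from -(λ+3) produces two zeros. The least zero gives the pointwise least solution
u₁, which lies below every supersolution obeying the same Neumann conditions and bounds
(`le_of_supersolution`). Touching the value 0 on [0, π/2] gives u_p (`exists_oddSol`). For k ≥ 2304
and all λ ≥ 0, u_p is strictly stable (`OddSol.strictly_stable`): the normalized linearized solution
z is positive with z'(π) > 0, so the shooting function is negative just left of u_p. If u₁ ≠ u_p and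
u₁ is strictly stable too, the shooting function is positive just right of u₁, and a zero in between
gives u₂ (`exists_intermediate`). The symmetry u ↦ -u(· + π) supplies u₄ and u₅.

Both conditions on u₁ follow from a strict nonpositive supersolution σ: it keeps u₁ below 0 at π,
where u_p is positive, and concavity of x³ - λx on x ≤ 0 yields strict stability
(`minimal_strictly_stable`). For λ ≥ 2 a constant serves as σ. For λ_b < λ ≤ 2 take λ' in (λ_b, λ),
where uniqueness fails; the minimal solution for λ' serves, provided it is nonpositive.

That sign is the heart of the matter (`minimal_nonpos`). If u₁(π) > 0, put κ = -u₁''(π)/k. Comparing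
energies with u_p forces κ > 1/2000 (`curvature_lower_bound`), whereas stability forces κ² ≤ 1280 ε
(`curvature_bound`), a contradiction for small ε. Finally, uniqueness holds at λ = 0, where the
nonlinearity is monotone, and fails for λ ≥ 2, so λ_b is finite. -/

open Set Real

/-! ### Grönwall estimates and one-sided comparison for second-order equations -/

/-- A function with controlled second derivative: Grönwall's inequality for `(h, h')`. -/
theorem second_order_gronwall {h h1 h2 : ℝ → ℝ} {K δ A a b : ℝ} (hK : 1 ≤ K) (hδ : 0 ≤ δ)
    (d1 : ∀ t ∈ Icc a b, HasDerivAt h (h1 t) t) (d2 : ∀ t ∈ Icc a b, HasDerivAt h1 (h2 t) t)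
    (hb : ∀ t ∈ Icc a b, |h2 t| ≤ K * |h t| + δ) (h0 : |h a| ≤ A) (h0' : |h1 a| ≤ A) :
    ∀ t ∈ Icc a b, |h t| ≤ gronwallBound A K δ (t - a) ∧ |h1 t| ≤ gronwallBound A K δ (t - a) := by
  have key := norm_le_gronwallBound_of_norm_deriv_right_le (f := fun t => (h t, h1 t))
    (f' := fun t => (h1 t, h2 t)) (δ := A) (K := K) (ε := δ) (a := a) (b := b)
    (fun t ht => ((d1 t ht).prodMk (d2 t ht)).continuousAt.continuousWithinAt)
    (fun t ht => ((d1 t (Ico_subset_Icc_self ht)).prodMk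
      (d2 t (Ico_subset_Icc_self ht))).hasDerivWithinAt)
    (by simp [Prod.norm_def, h0, h0'])
    (by
      intro t ht
      have := hb t (Ico_subset_Icc_self ht)
      simp only [Prod.norm_def, Real.norm_eq_abs]
      have hm1 := le_max_left |h t| |h1 t|
      have hm2 := le_max_right |h t| |h1 t|
      have hp : 0 ≤ |h t| := abs_nonneg _
      apply max_le
      · nlinarith
      · nlinarith)
  intro t ht
  have := key t ht
  simp only [Prod.norm_def, Real.norm_eq_abs] at this
  exact ⟨(le_max_left _ _).trans this, (le_max_right _ _).trans this⟩

theorem eq_zero_right_of_second_order {h h1 h2 : ℝ → ℝ} {K a b : ℝ}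
    (d1 : ∀ t ∈ Icc a b, HasDerivAt h (h1 t) t) (d2 : ∀ t ∈ Icc a b, HasDerivAt h1 (h2 t) t)
    (hb : ∀ t ∈ Icc a b, |h2 t| ≤ K * |h t|) (h0 : h a = 0) (h0' : h1 a = 0) :
    ∀ t ∈ Icc a b, h t = 0 ∧ h1 t = 0 := by
  intro t ht
  have := second_order_gronwall (K := max K 1) (δ := 0) (A := 0) (le_max_right _ _) le_rfl d1 d2
    (fun t ht => by
      have := hb t ht
      have h3 : K * |h t| ≤ max K 1 * |h t| :=
        mul_le_mul_of_nonneg_right (le_max_left _ _) (abs_nonneg _)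
      linarith) (by simp [h0]) (by simp [h0']) t ht
  simpa [gronwallBound_ε0_δ0] using this

theorem eq_zero_left_of_second_order {h h1 h2 : ℝ → ℝ} {K a b : ℝ}
    (d1 : ∀ t ∈ Icc a b, HasDerivAt h (h1 t) t) (d2 : ∀ t ∈ Icc a b, HasDerivAt h1 (h2 t) t)
    (hb : ∀ t ∈ Icc a b, |h2 t| ≤ K * |h t|) (h0 : h b = 0) (h0' : h1 b = 0) :
    ∀ t ∈ Icc a b, h t = 0 ∧ h1 t = 0 := by
  have hm : ∀ t ∈ Icc (-b) (-a), -t ∈ Icc a b := fun t ht => ⟨by linarith [ht.2], by linarith [ht.1]⟩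
  have := eq_zero_right_of_second_order (h := fun t => h (-t)) (h1 := fun t => -h1 (-t))
    (h2 := fun t => h2 (-t)) (K := K) (a := -b) (b := -a)
    (fun t ht => by simpa [Function.comp_def] using (d1 (-t) (hm t ht)).scomp t (hasDerivAt_neg t))
    (fun t ht => by simpa [Function.comp_def] using ((d2 (-t) (hm t ht)).scomp t (hasDerivAt_neg t)).fun_neg)
    (fun t ht => hb _ (hm t ht)) (by simpa using h0) (by simpa using h0')
  intro t ht
  simpa using this (-t) ⟨by linarith [ht.2], by linarith [ht.1]⟩

theorem eq_zero_of_second_order {h h1 h2 : ℝ → ℝ} {K a b t₀ : ℝ} (ht₀ : t₀ ∈ Icc a b)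
    (d1 : ∀ t ∈ Icc a b, HasDerivAt h (h1 t) t) (d2 : ∀ t ∈ Icc a b, HasDerivAt h1 (h2 t) t)
    (hb : ∀ t ∈ Icc a b, |h2 t| ≤ K * |h t|) (h0 : h t₀ = 0) (h0' : h1 t₀ = 0) :
    ∀ t ∈ Icc a b, h t = 0 ∧ h1 t = 0 := by
  intro t ht
  rcases le_total t t₀ with hle | hle
  · have hs : ∀ s ∈ Icc a t₀, s ∈ Icc a b := fun s hs => ⟨hs.1, hs.2.trans ht₀.2⟩
    exact eq_zero_left_of_second_order (fun s h => d1 s (hs s h)) (fun s h => d2 s (hs s h))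
      (fun s h => hb s (hs s h)) h0 h0' t ⟨ht.1, hle⟩
  · have hs : ∀ s ∈ Icc t₀ b, s ∈ Icc a b := fun s hs => ⟨ht₀.1.trans hs.1, hs.2⟩
    exact eq_zero_right_of_second_order (fun s h => d1 s (hs s h)) (fun s h => d2 s (hs s h))
      (fun s h => hb s (hs s h)) h0 h0' t ⟨hle, ht.2⟩

/-- One-sided comparison: `z'' ≤ K z`, `z ≥ 0` and a double zero on the left force `z = 0`. -/
theorem eq_zero_right_of_deriv2_le {z z1 z2 : ℝ → ℝ} {K a b : ℝ}
    (d1 : ∀ t ∈ Icc a b, HasDerivAt z (z1 t) t) (d2 : ∀ t ∈ Icc a b, HasDerivAt z1 (z2 t) t)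
    (hb : ∀ t ∈ Icc a b, z2 t ≤ K * z t) (hz : ∀ t ∈ Icc a b, 0 ≤ z t)
    (h0 : z a = 0) (h0' : z1 a = 0) : ∀ t ∈ Icc a b, z t = 0 := by
  -- Since K ≤ c², the operator z'' - c² z is nonpositive on z. It factors as (D + c)(D - c), and
  -- each factor is integrated with an exponential weight.
  set c := max K 1 with hc
  have hc1 : 1 ≤ c := le_max_right _ _
  have hcK : K ≤ c * c := by nlinarith [le_max_left K 1]
  have e1 : ∀ t, HasDerivAt (fun t => exp (c * t)) (exp (c * t) * c) t := fun t => by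
    simpa using ((hasDerivAt_id t).const_mul c).exp
  have e2 : ∀ t, HasDerivAt (fun t => exp (-c * t)) (exp (-c * t) * (-c)) t := fun t => by
    simpa using ((hasDerivAt_id t).const_mul (-c)).exp
  have A1 : AntitoneOn (fun t => exp (c * t) * (z1 t - c * z t)) (Icc a b) := by
    have hd : ∀ t ∈ Icc a b, HasDerivAt (fun t => exp (c * t) * (z1 t - c * z t))
        (exp (c * t) * (z2 t - c * c * z t)) t := fun t ht => by
      refine ((e1 t).fun_mul ((d2 t ht).fun_sub ((d1 t ht).const_mul c))).congr_deriv ?_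
      ring
    apply antitoneOn_of_deriv_nonpos (convex_Icc a b)
    · exact fun t ht => (hd t ht).continuousAt.continuousWithinAt
    · exact fun t ht => (hd t (interior_subset ht)).differentiableAt.differentiableWithinAt
    · intro t ht
      rw [(hd t (interior_subset ht)).deriv]
      have := hb t (interior_subset ht)
      have := hz t (interior_subset ht)
      exact mul_nonpos_of_nonneg_of_nonpos (exp_pos _).le (by nlinarith)
  have A2 : AntitoneOn (fun t => exp (-c * t) * z t) (Icc a b) := by
    have hd : ∀ t ∈ Icc a b, HasDerivAt (fun t => exp (-c * t) * z t)
        (exp (-c * t) * (z1 t - c * z t)) t := fun t ht => by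
      refine ((e2 t).mul (d1 t ht)).congr_deriv ?_
      ring
    apply antitoneOn_of_deriv_nonpos (convex_Icc a b)
    · exact fun t ht => (hd t ht).continuousAt.continuousWithinAt
    · exact fun t ht => (hd t (interior_subset ht)).differentiableAt.differentiableWithinAt
    · intro t ht
      have ht := interior_subset ht
      rw [(hd t ht).deriv]
      have := A1 ⟨le_rfl, ht.1.trans ht.2⟩ ht ht.1
      simp only [h0, h0', mul_zero, sub_zero] at this
      have h3 : z1 t - c * z t ≤ 0 := by
        by_contra h
        push Not at h
        have := mul_pos (exp_pos (c * t)) h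
        linarith
      exact mul_nonpos_of_nonneg_of_nonpos (exp_pos _).le h3
  intro t ht
  have := A2 ⟨le_rfl, ht.1.trans ht.2⟩ ht ht.1
  simp only [h0, mul_zero] at this
  have h3 := hz t ht
  have h4 := exp_pos (-c * t)
  by_contra h
  have := mul_pos h4 (lt_of_le_of_ne h3 (Ne.symm h))
  linarith

theorem eq_zero_of_deriv2_le {z z1 z2 : ℝ → ℝ} {K a b t₀ : ℝ} (ht₀ : t₀ ∈ Icc a b)
    (d1 : ∀ t ∈ Icc a b, HasDerivAt z (z1 t) t) (d2 : ∀ t ∈ Icc a b, HasDerivAt z1 (z2 t) t)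
    (hb : ∀ t ∈ Icc a b, z2 t ≤ K * z t) (hz : ∀ t ∈ Icc a b, 0 ≤ z t)
    (h0 : z t₀ = 0) (h0' : z1 t₀ = 0) : ∀ t ∈ Icc a b, z t = 0 := by
  intro t ht
  rcases le_total t t₀ with hle | hle
  · have hm : ∀ s ∈ Icc (-t₀) (-a), -s ∈ Icc a b :=
      fun s hs => ⟨by linarith [hs.2], by linarith [hs.1, ht₀.2]⟩
    have := eq_zero_right_of_deriv2_le (z := fun t => z (-t)) (z1 := fun t => -z1 (-t))
      (z2 := fun t => z2 (-t)) (K := K) (a := -t₀) (b := -a)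
      (fun s hs => by simpa [Function.comp_def] using (d1 (-s) (hm s hs)).scomp s (hasDerivAt_neg s))
      (fun s hs => by
        simpa [Function.comp_def] using ((d2 (-s) (hm s hs)).scomp s (hasDerivAt_neg s)).fun_neg)
      (fun s hs => hb _ (hm s hs)) (fun s hs => hz _ (hm s hs)) (by simpa using h0)
      (by simpa using h0') (-t) ⟨by linarith, by linarith [ht.1]⟩
    simpa using this
  · have hs : ∀ s ∈ Icc t₀ b, s ∈ Icc a b := fun s hs => ⟨ht₀.1.trans hs.1, hs.2⟩
    exact eq_zero_right_of_deriv2_le (fun s h => d1 s (hs s h)) (fun s h => d2 s (hs s h))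
      (fun s h => hb s (hs s h)) (fun s h => hz s (hs s h)) h0 h0' t ⟨hle, ht.2⟩

/-! ### Truncation and global existence -/

/-- Symmetric truncation of the real line to `[-M, M]`. -/
noncomputable def clamp (M x : ℝ) : ℝ := max (-M) (min M x)

theorem clamp_lipschitz (M : ℝ) : LipschitzWith 1 (clamp M) :=
  (LipschitzWith.id.const_min M).const_max (-M)

theorem clamp_eq {M x : ℝ} (h : |x| ≤ M) : clamp M x = x := by
  rw [abs_le] at h
  simp [clamp, h.1, h.2]

theorem abs_clamp_le {M : ℝ} (hM : 0 ≤ M) (x : ℝ) : |clamp M x| ≤ M := by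
  unfold clamp
  rw [abs_le]
  exact ⟨le_max_left _ _, max_le (by linarith) (min_le_left _ _)⟩

/-- Clamping the velocity makes the first-order field bounded, so Picard–Lindelöf reaches all of
[-T, T]. The acceleration bound then gives |v| ≤ C T, hence the clamp at A = C T never acts. -/
theorem exists_second_order_Icc {Φ : ℝ → ℝ → ℝ} {K : NNReal} {C T : ℝ} (hT : 0 < T)
    (hc : ∀ x, Continuous fun t => Φ t x) (hL : ∀ t, LipschitzWith K (Φ t))
    (hC : ∀ t x, |Φ t x| ≤ C) (x₀ : ℝ) :
    ∃ u v : ℝ → ℝ, u 0 = x₀ ∧ v 0 = 0 ∧ (∀ t ∈ Icc (-T) T, HasDerivWithinAt u (v t) (Icc (-T) T) t) ∧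
      ∀ t ∈ Icc (-T) T, HasDerivWithinAt v (Φ t (u t)) (Icc (-T) T) t := by
  have hC0 : 0 ≤ C := (abs_nonneg _).trans (hC 0 0)
  set A : ℝ := C * T with hA
  have hA0 : 0 ≤ A := by positivity
  set L : NNReal := ⟨max A C, le_max_of_le_left hA0⟩ with hLdef
  set R : NNReal := L * ⟨T, hT.le⟩ with hR
  have h0 : (0 : ℝ) ∈ Icc (-T) T := ⟨by linarith, hT.le⟩
  have hPL : IsPicardLindelof (fun t (p : ℝ × ℝ) => (clamp A p.2, Φ t p.1)) (⟨0, h0⟩ : Icc (-T) T)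
      ((x₀, 0) : ℝ × ℝ) R 0 L (max 1 K) := by
    refine ⟨?_, ?_, ?_, ?_⟩
    · intro t _
      apply LipschitzWith.lipschitzOnWith
      have l1 := (clamp_lipschitz A).comp (LipschitzWith.prod_snd (α := ℝ) (β := ℝ))
      have l2 := (hL t).comp (LipschitzWith.prod_fst (α := ℝ) (β := ℝ))
      simpa using l1.prodMk l2
    · intro p _
      exact (continuous_const.prodMk (hc p.1)).continuousOn
    · intro t _ p _
      simp only [Prod.norm_def, Real.norm_eq_abs]
      exact max_le ((abs_clamp_le hA0 _).trans (le_max_left _ _)) ((hC _ _).trans (le_max_right _ _))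
    · simp only [sub_zero, zero_sub, neg_neg, max_self, NNReal.coe_zero, hR]
      exact le_rfl
  obtain ⟨γ, hγ0, hγ⟩ := hPL.exists_eq_forall_mem_Icc_hasDerivWithinAt₀
  simp only at hγ0
  have dv : ∀ t ∈ Icc (-T) T, HasDerivWithinAt (fun t => (γ t).2) (Φ t (γ t).1) (Icc (-T) T) t :=
    fun t ht => (hγ t ht).snd
  have du : ∀ t ∈ Icc (-T) T, HasDerivWithinAt (fun t => (γ t).1) (clamp A (γ t).2) (Icc (-T) T) t :=
    fun t ht => (hγ t ht).fst
  have hb : ∀ t ∈ Icc (-T) T, |(γ t).2| ≤ A := by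
    intro t ht
    have := (convex_Icc (-T) T).norm_image_sub_le_of_norm_hasDerivWithin_le dv
      (fun t _ => by simpa using hC t (γ t).1) h0 ht
    simp only [hγ0, sub_zero, Real.norm_eq_abs] at this
    refine this.trans ?_
    rw [hA]
    exact mul_le_mul_of_nonneg_left (abs_le.2 ht) hC0
  refine ⟨fun t => (γ t).1, fun t => (γ t).2, by simp [hγ0], by simp [hγ0], ?_, dv⟩
  intro t ht
  have := du t ht
  rwa [clamp_eq (hb t ht)] at this

/-- The solutions on [-(n+1), n+1] agree on overlaps by uniqueness; at t the one with n = ⌈|t|⌉ is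
read off. -/
theorem exists_second_order {Φ : ℝ → ℝ → ℝ} {K : NNReal} {C : ℝ}
    (hc : ∀ x, Continuous fun t => Φ t x) (hL : ∀ t, LipschitzWith K (Φ t))
    (hC : ∀ t x, |Φ t x| ≤ C) (x₀ : ℝ) :
    ∃ u v : ℝ → ℝ, u 0 = x₀ ∧ v 0 = 0 ∧ (∀ t, HasDerivAt u (v t) t) ∧
      ∀ t, HasDerivAt v (Φ t (u t)) t := by
  have H := fun n : ℕ => exists_second_order_Icc (T := (n : ℝ) + 1) (by positivity) hc hL hC x₀
  choose u v hu0 hv0 hu hv using H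
  have mem : ∀ (n : ℕ) (t : ℝ), t ∈ Ioo (-((n : ℝ) + 1)) ((n : ℝ) + 1) →
      Icc (-((n : ℝ) + 1)) ((n : ℝ) + 1) ∈ nhds t := fun n t ht => Icc_mem_nhds ht.1 ht.2
  have du : ∀ (n : ℕ) (t : ℝ), t ∈ Ioo (-((n : ℝ) + 1)) ((n : ℝ) + 1) →
      HasDerivAt (u n) (v n t) t := fun n t ht =>
    (hu n t (Ioo_subset_Icc_self ht)).hasDerivAt (mem n t ht)
  have dv : ∀ (n : ℕ) (t : ℝ), t ∈ Ioo (-((n : ℝ) + 1)) ((n : ℝ) + 1) →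
      HasDerivAt (v n) (Φ t (u n t)) t := fun n t ht =>
    (hv n t (Ioo_subset_Icc_self ht)).hasDerivAt (mem n t ht)
  have agree : ∀ (n m : ℕ) (t : ℝ), |t| < (n : ℝ) + 1 → |t| < (m : ℝ) + 1 →
      u n t = u m t ∧ v n t = v m t := by
    intro n m t hn hm
    have hsub : ∀ (n : ℕ), |t| < (n : ℝ) + 1 → ∀ s ∈ Icc (-|t|) |t|,
        s ∈ Ioo (-((n : ℝ) + 1)) ((n : ℝ) + 1) := fun n hn s hs =>
      ⟨by linarith [hs.1], by linarith [hs.2]⟩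
    have := eq_zero_of_second_order (h := fun s => u n s - u m s) (h1 := fun s => v n s - v m s)
      (h2 := fun s => Φ s (u n s) - Φ s (u m s)) (K := K) (a := -|t|) (b := |t|) (t₀ := 0)
      ⟨by simp, by simp⟩
      (fun s hs => (du n s (hsub n hn s hs)).sub (du m s (hsub m hm s hs)))
      (fun s hs => (dv n s (hsub n hn s hs)).sub (dv m s (hsub m hm s hs)))
      (fun s _ => by simpa [Real.dist_eq] using (hL s).dist_le_mul (u n s) (u m s))
      (by simp [hu0]) (by simp [hv0]) t ⟨neg_abs_le t, le_abs_self t⟩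
    exact ⟨sub_eq_zero.1 this.1, sub_eq_zero.1 this.2⟩
  have hfl : ∀ t : ℝ, |t| < (⌈|t|⌉₊ : ℝ) + 1 := fun t => by linarith [Nat.le_ceil |t|]
  have ev : ∀ t : ℝ, ∀ᶠ s in nhds t, |s| < ((⌈|t|⌉₊ : ℕ) : ℝ) + 1 := fun t =>
    continuous_abs.continuousAt.eventually_lt continuousAt_const (hfl t)
  refine ⟨fun t => u ⌈|t|⌉₊ t, fun t => v ⌈|t|⌉₊ t, by simp [hu0], by simp [hv0], ?_, ?_⟩
  · intro t
    refine (du ⌈|t|⌉₊ t (abs_lt.1 (hfl t))).congr_of_eventuallyEq ?_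
    filter_upwards [ev t] with s hs
    exact (agree _ _ s (hfl s) hs).1
  · intro t
    refine (dv ⌈|t|⌉₊ t (abs_lt.1 (hfl t))).congr_of_eventuallyEq ?_
    filter_upwards [ev t] with s hs
    exact (agree _ _ s (hfl s) hs).2

/-! ### Wronskians and monotonicity on intervals -/

/-- If `w' z - z' w` is strictly decreasing, `z > 0`, `w a = 0` and `w b ≥ 0`, then `w > 0` inside. -/
theorem pos_of_wronskian_strictAnti {w w1 z z1 : ℝ → ℝ} {a b : ℝ}
    (dw : ∀ t ∈ Icc a b, HasDerivAt w (w1 t) t) (dz : ∀ t ∈ Icc a b, HasDerivAt z (z1 t) t)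
    (hz : ∀ t ∈ Icc a b, 0 < z t) (hN : StrictAntiOn (fun t => w1 t * z t - z1 t * w t) (Icc a b))
    (ha : w a = 0) (hb : 0 ≤ w b) : ∀ t ∈ Ioo a b, 0 < w t := by
  intro t ht
  by_contra hneg
  push Not at hneg
  -- The quotient w/z has derivative Wronskian/z². If w t ≤ 0, mean value points on the two sides of
  -- t carry a nonpositive and then a nonnegative Wronskian, against strict decrease.
  have hd : ∀ s ∈ Icc a b, HasDerivAt (fun s => w s / z s)
      ((w1 s * z s - z1 s * w s) / z s ^ 2) s := fun s hs => by
    refine ((dw s hs).div (dz s hs) (hz s hs).ne').congr_deriv ?_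
    ring
  have hcont : ContinuousOn (fun s => w s / z s) (Icc a b) :=
    fun s hs => (hd s hs).continuousAt.continuousWithinAt
  have hab : a < b := ht.1.trans ht.2
  obtain ⟨c, hc, hc'⟩ := exists_hasDerivAt_eq_slope (fun s => w s / z s) _ ht.1
    (hcont.mono (Icc_subset_Icc le_rfl ht.2.le))
    (fun s hs => hd s ⟨hs.1.le, hs.2.le.trans ht.2.le⟩)
  obtain ⟨d, hd1, hd'⟩ := exists_hasDerivAt_eq_slope (fun s => w s / z s) _ ht.2
    (hcont.mono (Icc_subset_Icc ht.1.le le_rfl))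
    (fun s hs => hd s ⟨ht.1.le.trans hs.1.le, hs.2.le⟩)
  have hcm : c ∈ Icc a b := ⟨hc.1.le, (hc.2.trans ht.2).le⟩
  have hdm : d ∈ Icc a b := ⟨(ht.1.trans hd1.1).le, hd1.2.le⟩
  have ht' : w t / z t ≤ 0 := div_nonpos_of_nonpos_of_nonneg hneg (hz t ⟨ht.1.le, ht.2.le⟩).le
  have hb' : 0 ≤ w b / z b := div_nonneg hb (hz b ⟨hab.le, le_rfl⟩).le
  have h1 : (w1 c * z c - z1 c * w c) / z c ^ 2 ≤ 0 := by
    rw [hc', ha, zero_div, sub_zero]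
    exact div_nonpos_of_nonpos_of_nonneg ht' (by linarith [ht.1])
  have h2 : 0 ≤ (w1 d * z d - z1 d * w d) / z d ^ 2 := by
    rw [hd']
    exact div_nonneg (by linarith) (by linarith [ht.2])
  have hzc := pow_pos (hz c hcm) 2
  have hzd := pow_pos (hz d hdm) 2
  have h1' : w1 c * z c - z1 c * w c ≤ 0 := by
    by_contra h; push Not at h; linarith [div_pos h hzc]
  have h2' : 0 ≤ w1 d * z d - z1 d * w d := by
    by_contra h; push Not at h; linarith [div_neg_of_neg_of_pos h hzd]
  have := hN hcm hdm (hc.2.trans hd1.1)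
  simp only at this
  linarith

theorem monotoneOn_Icc_of_hasDerivAt {f f' : ℝ → ℝ} {a b : ℝ}
    (d : ∀ t ∈ Icc a b, HasDerivAt f (f' t) t) (h : ∀ t ∈ Ioo a b, 0 ≤ f' t) :
    MonotoneOn f (Icc a b) := by
  apply monotoneOn_of_deriv_nonneg (convex_Icc a b)
  · exact fun t ht => (d t ht).continuousAt.continuousWithinAt
  · exact fun t ht => (d t (interior_subset ht)).differentiableAt.differentiableWithinAt
  · intro t ht
    rw [(d t (interior_subset ht)).deriv]
    rw [interior_Icc] at ht
    exact h t ht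

theorem antitoneOn_Icc_of_hasDerivAt {f f' : ℝ → ℝ} {a b : ℝ}
    (d : ∀ t ∈ Icc a b, HasDerivAt f (f' t) t) (h : ∀ t ∈ Ioo a b, f' t ≤ 0) :
    AntitoneOn f (Icc a b) := by
  have := monotoneOn_Icc_of_hasDerivAt (f := fun t => -f t) (f' := fun t => -f' t)
    (fun t ht => (d t ht).fun_neg) (fun t ht => by linarith [h t ht])
  exact fun x hx y hy hxy => by linarith [this hx hy hxy]

theorem strictMonoOn_Icc_of_hasDerivAt {f f' : ℝ → ℝ} {a b : ℝ}
    (d : ∀ t ∈ Icc a b, HasDerivAt f (f' t) t) (h : ∀ t ∈ Ioo a b, 0 < f' t) :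
    StrictMonoOn f (Icc a b) := by
  apply strictMonoOn_of_deriv_pos (convex_Icc a b)
  · exact fun t ht => (d t ht).continuousAt.continuousWithinAt
  · intro t ht
    rw [(d t (interior_subset ht)).deriv]
    rw [interior_Icc] at ht
    exact h t ht

theorem strictAntiOn_Icc_of_hasDerivAt {f f' : ℝ → ℝ} {a b : ℝ}
    (d : ∀ t ∈ Icc a b, HasDerivAt f (f' t) t) (h : ∀ t ∈ Ioo a b, f' t < 0) :
    StrictAntiOn f (Icc a b) := by
  have := strictMonoOn_Icc_of_hasDerivAt (f := fun t => -f t) (f' := fun t => -f' t)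
    (fun t ht => (d t ht).fun_neg) (fun t ht => by linarith [h t ht])
  exact fun x hx y hy hxy => by linarith [this hx hy hxy]

theorem exists_pos_right_of_hasDerivAt {v : ℝ → ℝ} {c t₀ : ℝ} (dv : HasDerivAt v c t₀)
    (h0 : v t₀ = 0) (hc : 0 < c) : ∃ δ > 0, ∀ t ∈ Ioc t₀ (t₀ + δ), 0 < v t := by
  have := eventually_nhdsWithin_sign_eq_of_deriv_pos (by rwa [dv.deriv]) h0
  obtain ⟨δ, hδ, H⟩ := Metric.eventually_nhds_iff.1 this
  refine ⟨δ / 2, by linarith, fun t ht => ?_⟩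
  have h1 := H (y := t) (by rw [Real.dist_eq, abs_of_pos (by linarith [ht.1])]; linarith [ht.2])
  exact sign_eq_one_iff.1 (h1.trans (sign_pos (by linarith [ht.1])))

theorem exists_lt_right_of_deriv2_pos {u v : ℝ → ℝ} {c t₀ : ℝ} (du : ∀ t, HasDerivAt u (v t) t)
    (dv : HasDerivAt v c t₀) (h0 : v t₀ = 0) (hc : 0 < c) :
    ∃ δ > 0, ∀ t ∈ Ioc t₀ (t₀ + δ), u t₀ < u t := by
  obtain ⟨δ, hδ, H⟩ := exists_pos_right_of_hasDerivAt dv h0 hc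
  refine ⟨δ, hδ, fun t ht => ?_⟩
  have := strictMonoOn_Icc_of_hasDerivAt (a := t₀) (b := t₀ + δ) (fun t _ => du t)
    (fun t ht => H t (Ioo_subset_Ioc_self ht))
  exact this ⟨le_rfl, by linarith⟩ ⟨ht.1.le, ht.2⟩ ht.1

/-! ### Symmetries of the forced equation and the maximum principle -/

/-- Solutions, written with their derivative, of `u'' = k (g u + cos t)`. -/
def ForcedSol (k : ℝ) (g : ℝ → ℝ) (u v : ℝ → ℝ) : Prop :=
  (∀ t, HasDerivAt u (v t) t) ∧ ∀ t, HasDerivAt v (k * (g (u t) + cos t)) t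

namespace ForcedSol

variable {k : ℝ} {g u v u' v' : ℝ → ℝ}

theorem continuous (h : ForcedSol k g u v) : Continuous u :=
  continuous_iff_continuousAt.2 fun t => (h.1 t).continuousAt

theorem unique (hg : LocallyLipschitz g) (h : ForcedSol k g u v) (h' : ForcedSol k g u' v')
    {t₀ : ℝ} (e0 : u t₀ = u' t₀) (e1 : v t₀ = v' t₀) (t : ℝ) : u t = u' t ∧ v t = v' t := by
  set I := Icc (min t t₀) (max t t₀) with hI
  have hcomp : IsCompact (u '' I ∪ u' '' I) :=
    (isCompact_Icc.image h.continuous).union (isCompact_Icc.image h'.continuous)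
  obtain ⟨K, hK⟩ := hg.locallyLipschitzOn.exists_lipschitzOnWith_of_compact hcomp
  have := eq_zero_of_second_order (h := fun s => u s - u' s) (h1 := fun s => v s - v' s)
    (h2 := fun s => k * (g (u s) + cos s) - k * (g (u' s) + cos s)) (K := |k| * K)
    (a := min t t₀) (b := max t t₀) (t₀ := t₀)
    ⟨min_le_right _ _, le_max_right _ _⟩ (fun s _ => (h.1 s).sub (h'.1 s))
    (fun s _ => (h.2 s).sub (h'.2 s))
    (fun s hs => by
      have h1 := hK.dist_le_mul (u s) (Or.inl ⟨s, hs, rfl⟩) (u' s) (Or.inr ⟨s, hs, rfl⟩)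
      rw [Real.dist_eq, Real.dist_eq] at h1
      rw [show k * (g (u s) + cos s) - k * (g (u' s) + cos s) = k * (g (u s) - g (u' s)) by ring,
        abs_mul, mul_assoc]
      exact mul_le_mul_of_nonneg_left h1 (abs_nonneg _))
    (sub_eq_zero.2 e0) (sub_eq_zero.2 e1) t ⟨min_le_left _ _, le_max_left _ _⟩
  exact ⟨sub_eq_zero.1 this.1, sub_eq_zero.1 this.2⟩

theorem even (hg : LocallyLipschitz g) (h : ForcedSol k g u v) (h0 : v 0 = 0) (t : ℝ) :
    u (-t) = u t ∧ v (-t) = -v t := by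
  have hr : ForcedSol k g (fun t => u (0 - t)) (fun t => -v (0 - t)) :=
    ⟨fun t => (h.1 (0 - t)).comp_const_sub _ _, fun t => by
      simpa using ((h.2 (0 - t)).comp_const_sub _ _).fun_neg⟩
  have := hr.unique hg h (t₀ := 0) (by simp) (by simp [h0]) t
  simp only [zero_sub] at this
  exact ⟨this.1, by linarith [this.2]⟩

theorem reflect_pi (hg : LocallyLipschitz g) (h : ForcedSol k g u v) (h0 : v π = 0) (t : ℝ) :
    u (2 * π - t) = u t ∧ v (2 * π - t) = -v t := by
  have hr : ForcedSol k g (fun t => u (2 * π - t)) (fun t => -v (2 * π - t)) :=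
    ⟨fun t => (h.1 (2 * π - t)).comp_const_sub _ _, fun t => by
      simpa [cos_two_pi_sub] using ((h.2 (2 * π - t)).comp_const_sub _ _).fun_neg⟩
  have e : 2 * π - π = π := by ring
  have := hr.unique hg h (t₀ := π) (by simp [e]) (by simp [e, h0]) t
  exact ⟨this.1, by linarith [this.2]⟩

theorem periodic (hg : LocallyLipschitz g) (h : ForcedSol k g u v) (h0 : v 0 = 0) (hπ : v π = 0) :
    Function.Periodic u (2 * π) := fun t => by
  have h1 := (h.reflect_pi hg hπ (-t)).1
  rw [(h.even hg h0 t).1] at h1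
  rw [← h1]
  congr 1
  ring

theorem neg_shift (hodd : ∀ x, g (-x) = -g x) (h : ForcedSol k g u v) :
    ForcedSol k g (fun t => -u (t + π)) (fun t => -v (t + π)) :=
  ⟨fun t => ((h.1 (t + π)).comp_add_const _ _).fun_neg, fun t => by
    refine ((h.2 (t + π)).comp_add_const _ _).fun_neg.congr_deriv ?_
    rw [hodd, cos_add_pi]
    ring⟩

theorem neg_reflect (hodd : ∀ x, g (-x) = -g x) (h : ForcedSol k g u v) :
    ForcedSol k g (fun t => -u (π - t)) (fun t => v (π - t)) :=
  ⟨fun t => by simpa using ((h.1 (π - t)).comp_const_sub _ _).fun_neg, fun t => by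
    refine ((h.2 (π - t)).comp_const_sub _ _).congr_deriv ?_
    rw [hodd, cos_pi_sub]
    ring⟩

/-- The Neumann conditions extend u periodically, so a maximum over one period is global and
critical even at 0 or π. If its value were at least M, the acceleration there would be positive and
u would rise further. -/
theorem lt_of_neumann (hg : LocallyLipschitz g) (hk : 0 < k) (h : ForcedSol k g u v)
    (h0 : v 0 = 0) (hπ : v π = 0) {M : ℝ} (hM : ∀ x, M ≤ x → 1 < g x) (t : ℝ) : u t < M := by
  have hper := h.periodic hg h0 hπ
  obtain ⟨s, hs, hmax⟩ := isCompact_Icc.exists_isMaxOn (s := Icc 0 (2 * π))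
    ⟨0, le_rfl, two_pi_pos.le⟩ h.continuous.continuousOn
  have hmax' : ∀ t, u t ≤ u s := fun t => by
    obtain ⟨y, hy, e⟩ := hper.exists_mem_Ico₀ two_pi_pos t
    rw [e]
    exact hmax ⟨hy.1, hy.2.le⟩
  refine (hmax' t).trans_lt ?_
  by_contra hge
  push Not at hge
  have hv : v s = 0 := IsLocalMax.hasDerivAt_eq_zero (f := u)
    (Filter.Eventually.of_forall hmax') (h.1 s)
  obtain ⟨δ, hδ, H⟩ := exists_lt_right_of_deriv2_pos h.1 (h.2 s) hv
    (mul_pos hk (by linarith [hM _ hge, neg_one_le_cos s]))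
  have := H (s + δ) ⟨by linarith, le_rfl⟩
  linarith [hmax' (s + δ)]

theorem abs_lt_of_neumann (hg : LocallyLipschitz g) (hodd : ∀ x, g (-x) = -g x) (hk : 0 < k)
    (h : ForcedSol k g u v) (h0 : v 0 = 0) (hπ : v π = 0) {M : ℝ} (hM : ∀ x, M ≤ x → 1 < g x)
    (t : ℝ) : |u t| < M := by
  have h1 := h.lt_of_neumann hg hk h0 hπ hM t
  have e : v (π + π) = 0 := by
    have := (h.reflect_pi hg hπ 0).2
    rw [show 2 * π - 0 = π + π by ring, h0] at this
    simpa using this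
  have h2 := (h.neg_shift hodd).lt_of_neumann hg hk (by simp [hπ]) (by simp [e]) hM (t - π)
  simp only [sub_add_cancel] at h2
  exact abs_lt.2 ⟨by linarith, h1⟩

theorem congr_nonlinearity {g' : ℝ → ℝ} (h : ForcedSol k g u v) (e : ∀ t, g (u t) = g' (u t)) :
    ForcedSol k g' u v :=
  ⟨h.1, fun t => by rw [← e]; exact h.2 t⟩

end ForcedSol

/-! ### The Duffing nonlinearity and its truncation -/

/-- The Duffing nonlinearity. -/
def duffing (lam x : ℝ) : ℝ := x ^ 3 - lam * x

/-- The Duffing nonlinearity, frozen outside `[-M, M]`. -/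
noncomputable def truncDuffing (lam M x : ℝ) : ℝ := duffing lam (clamp M x)

theorem duffing_locallyLipschitz (lam : ℝ) : LocallyLipschitz (duffing lam) := by
  have : ContDiff ℝ 1 (duffing lam) := by
    unfold duffing
    fun_prop
  exact this.locallyLipschitz

theorem duffing_neg (lam x : ℝ) : duffing lam (-x) = -duffing lam x := by
  unfold duffing; ring

theorem duffing_sub (lam x y : ℝ) :
    duffing lam x - duffing lam y = (x ^ 2 + x * y + y ^ 2 - lam) * (x - y) := by
  unfold duffing; ring

theorem truncDuffing_locallyLipschitz (lam M : ℝ) : LocallyLipschitz (truncDuffing lam M) :=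
  (duffing_locallyLipschitz lam).comp (clamp_lipschitz M).locallyLipschitz

theorem truncDuffing_eq {lam M x : ℝ} (h : |x| ≤ M) : truncDuffing lam M x = duffing lam x := by
  rw [truncDuffing, clamp_eq h]

theorem clamp_neg {M : ℝ} (hM : 0 ≤ M) (x : ℝ) : clamp M (-x) = -clamp M x := by
  unfold clamp
  rcases le_total M x with h | h <;> rcases le_total (-M) x with h' | h' <;>
    simp only [min_def, max_def] <;> split_ifs <;> linarith

theorem truncDuffing_neg {lam M : ℝ} (hM : 0 ≤ M) (x : ℝ) :
    truncDuffing lam M (-x) = -truncDuffing lam M x := by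
  rw [truncDuffing, clamp_neg hM, duffing_neg, truncDuffing]

theorem truncDuffing_lipschitz {lam M : ℝ} (hlam : 0 ≤ lam) (hM : 0 ≤ M) (x y : ℝ) :
    |truncDuffing lam M x - truncDuffing lam M y| ≤ (3 * M ^ 2 + lam) * |x - y| := by
  rw [truncDuffing, truncDuffing, duffing_sub, abs_mul]
  have h1 := abs_le.1 (abs_clamp_le hM x)
  have h2 := abs_le.1 (abs_clamp_le hM y)
  have h3 : |clamp M x - clamp M y| ≤ |x - y| := by
    simpa [Real.dist_eq] using (clamp_lipschitz M).dist_le_mul x y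
  refine mul_le_mul ?_ h3 (abs_nonneg _) (by positivity)
  rw [abs_le]
  constructor <;> nlinarith [sq_nonneg (clamp M x + clamp M y), sq_nonneg (clamp M x - clamp M y)]

/-- From `lam + 2` on the nonlinearity beats the forcing amplitude 1; this fixes both the a priori
bound and the truncation level. -/
theorem one_lt_duffing {lam x : ℝ} (hlam : 0 ≤ lam) (hx : lam + 2 ≤ x) : 1 < duffing lam x := by
  unfold duffing
  have h1 : 1 ≤ x ^ 2 - lam := by nlinarith
  nlinarith

theorem clamp_of_le {M x : ℝ} (hM : 0 ≤ M) (h : M ≤ x) : clamp M x = M := by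
  unfold clamp
  rw [min_eq_left h, max_eq_right (by linarith)]

theorem one_lt_truncDuffing {lam x : ℝ} (hlam : 0 ≤ lam) (hx : lam + 2 ≤ x) :
    1 < truncDuffing lam (lam + 2) x := by
  rw [truncDuffing, clamp_of_le (by linarith) hx]
  exact one_lt_duffing hlam le_rfl

theorem abs_truncDuffing_le {lam M : ℝ} (hlam : 0 ≤ lam) (hM : 0 ≤ M) (x : ℝ) :
    |truncDuffing lam M x| ≤ (3 * M ^ 2 + lam) * M := by
  have h := truncDuffing_lipschitz hlam hM (clamp M x) 0
  have e0 : truncDuffing lam M 0 = 0 := by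
    rw [truncDuffing_eq (by simpa using hM)]; simp [duffing]
  have e1 : truncDuffing lam M (clamp M x) = truncDuffing lam M x := by
    rw [truncDuffing_eq (abs_clamp_le hM x), truncDuffing]
  rw [e0, e1, sub_zero, sub_zero] at h
  exact h.trans (mul_le_mul_of_nonneg_left (abs_clamp_le hM x) (by positivity))

/-! ### Neumann solutions -/

/-- A solution of the Duffing equation with the two Neumann conditions, together with `u'`. -/
def NeumannSol (k lam : ℝ) (u v : ℝ → ℝ) : Prop :=
  ForcedSol k (duffing lam) u v ∧ v 0 = 0 ∧ v π = 0

theorem isDuffingSolution_iff {ε lam : ℝ} (hε : 0 < ε) {u : ℝ → ℝ} :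
    IsDuffingSolution ε lam u ↔ ForcedSol (ε ^ 2)⁻¹ (duffing lam) u (deriv u) := by
  have hε2 : ε ^ 2 ≠ 0 := by positivity
  constructor
  · rintro ⟨h1, h2⟩
    have h1' : ContDiff ℝ (1 + 1) u := by
      convert h1 using 1
      norm_num
    have hd := contDiff_succ_iff_deriv.1 h1'
    refine ⟨fun t => (hd.1 t).hasDerivAt, fun t => ?_⟩
    have h3 := ((hd.2.2.differentiable one_ne_zero) t).hasDerivAt
    refine h3.congr_deriv ?_
    have := h2 t
    rw [duffing, ← this]
    field_simp
  · intro h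
    have hd2 : deriv (deriv u) = fun t => (ε ^ 2)⁻¹ * (duffing lam (u t) + cos t) :=
      funext fun t => (h.2 t).deriv
    constructor
    · have h1 : ContDiff ℝ (1 + 1) u := by
        refine contDiff_succ_iff_deriv.2 ⟨fun t => (h.1 t).differentiableAt, by simp, ?_⟩
        refine contDiff_one_iff_deriv.2 ⟨fun t => (h.2 t).differentiableAt, ?_⟩
        rw [hd2]
        have := h.continuous
        unfold duffing
        fun_prop
      convert h1 using 1
      norm_num
    · intro t
      rw [hd2]
      simp only [duffing]
      field_simp

theorem ForcedSol.deriv_eq {k : ℝ} {g u v : ℝ → ℝ} (h : ForcedSol k g u v) : deriv u = v :=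
  funext fun t => (h.1 t).deriv

theorem isNeumannSolution_iff {ε lam : ℝ} (hε : 0 < ε) {u : ℝ → ℝ} :
    IsNeumannSolution ε lam u ↔ ∃ v, NeumannSol (ε ^ 2)⁻¹ lam u v := by
  constructor
  · rintro ⟨h, h0, hπ⟩
    exact ⟨_, (isDuffingSolution_iff hε).1 h, h0, hπ⟩
  · rintro ⟨v, h, h0, hπ⟩
    have e := h.deriv_eq
    exact ⟨(isDuffingSolution_iff hε).2 (by rwa [e]), by rw [e, h0], by rw [e, hπ]⟩

namespace NeumannSol

variable {k lam : ℝ} {u v u' v' : ℝ → ℝ}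

theorem even (h : NeumannSol k lam u v) (t : ℝ) : u (-t) = u t :=
  (h.1.even (duffing_locallyLipschitz lam) h.2.1 t).1

theorem periodic (h : NeumannSol k lam u v) : Function.Periodic u (2 * π) :=
  h.1.periodic (duffing_locallyLipschitz lam) h.2.1 h.2.2

theorem abs_lt (hk : 0 < k) (hlam : 0 ≤ lam) (h : NeumannSol k lam u v) (t : ℝ) :
    |u t| < lam + 2 :=
  h.1.abs_lt_of_neumann (duffing_locallyLipschitz lam) (duffing_neg lam) hk h.2.1 h.2.2
    (fun _ hx => one_lt_duffing hlam hx) t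

theorem neg_shift (h : NeumannSol k lam u v) :
    NeumannSol k lam (fun t => -u (t + π)) (fun t => -v (t + π)) := by
  refine ⟨h.1.neg_shift (duffing_neg lam), by simp [h.2.2], ?_⟩
  have := (h.1.reflect_pi (duffing_locallyLipschitz lam) h.2.2 0).2
  rw [show 2 * π - 0 = π + π by ring, h.2.1] at this
  simpa using this

theorem shift_eq (h : NeumannSol k lam u v) (t : ℝ) : u (t + π) = u (π - t) := by
  rw [← (h.1.reflect_pi (duffing_locallyLipschitz lam) h.2.2 (π - t)).1]
  congr 1
  ring

theorem unique (h : NeumannSol k lam u v) (h' : NeumannSol k lam u' v') {t₀ : ℝ}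
    (e0 : u t₀ = u' t₀) (e1 : v t₀ = v' t₀) : u = u' :=
  funext fun t => (h.1.unique (duffing_locallyLipschitz lam) h'.1 e0 e1 t).1

/-- Periodicity and reflection in π fold the line onto [0, π]. The folded point is the same for all
solutions, so pointwise inequalities on [0, π] transfer to the line. -/
theorem _root_.exists_mem_Icc_neumann (k lam t : ℝ) :
    ∃ s ∈ Icc 0 π, ∀ u' v', NeumannSol k lam u' v' → u' t = u' s := by
  set s : ℝ := toIcoMod two_pi_pos 0 t
  have hs := toIcoMod_mem_Ico two_pi_pos 0 t
  have hper : ∀ u' v', NeumannSol k lam u' v' → u' t = u' s := fun u' v' h' => by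
    have := h'.periodic.sub_zsmul_eq (x := t) (toIcoDiv two_pi_pos 0 t)
    exact this.symm
  rcases le_total s π with hle | hle
  · exact ⟨s, ⟨hs.1, hle⟩, hper⟩
  · refine ⟨2 * π - s, ⟨by linarith [hs.2], by linarith⟩, fun u' v' h' => ?_⟩
    rw [(h'.1.reflect_pi (duffing_locallyLipschitz lam) h'.2.2 s).1]
    exact hper u' v' h'

/-- Ordered distinct Neumann solutions are strictly ordered everywhere. -/
theorem lt_of_le (h : NeumannSol k lam u v) (h' : NeumannSol k lam u' v')
    (hle : ∀ t ∈ Icc 0 π, u t ≤ u' t) (hne : u ≠ u') (t : ℝ) : u t < u' t := by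
  have hle' : ∀ t, u t ≤ u' t := fun t => by
    obtain ⟨s, hs, H⟩ := exists_mem_Icc_neumann k lam t
    rw [H u v h, H u' v' h']
    exact hle s hs
  refine lt_of_le_of_ne (hle' t) fun e => hne ?_
  have hmin : IsLocalMin (fun s => u' s - u s) t :=
    Filter.Eventually.of_forall fun s => by simp [e, hle' s]
  have := hmin.hasDerivAt_eq_zero ((h'.1.1 t).sub (h.1.1 t))
  exact h.unique h' e (by linarith)

end NeumannSol

/-! ### Zeros of nonnegative functions and the touching principle -/

theorem deriv_nonpos_of_nonneg_left {z : ℝ → ℝ} {a b c : ℝ} (hab : a < b) (d : HasDerivAt z c b)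
    (h0 : z b = 0) (hz : ∀ t ∈ Icc a b, 0 ≤ z t) : c ≤ 0 := by
  by_contra hc
  push Not at hc
  have e : HasDerivAt (fun t => -z (b - t)) c 0 := by
    have : HasDerivAt z c (b - 0) := by simpa using d
    simpa using (this.comp_const_sub _ _).fun_neg
  obtain ⟨δ, hδ, H⟩ := exists_pos_right_of_hasDerivAt e (by simp [h0]) hc
  have hm : 0 < min δ (b - a) := lt_min hδ (by linarith)
  have h1 := H (min δ (b - a)) ⟨hm, by simp⟩
  have h2 := hz (b - min δ (b - a)) ⟨by linarith [min_le_right δ (b - a)], by linarith⟩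
  linarith

theorem deriv_nonneg_of_nonneg_right {z : ℝ → ℝ} {a b c : ℝ} (hab : a < b) (d : HasDerivAt z c a)
    (h0 : z a = 0) (hz : ∀ t ∈ Icc a b, 0 ≤ z t) : 0 ≤ c := by
  have e : HasDerivAt (fun t => z (a - t)) (-c) 0 :=
    HasDerivAt.comp_const_sub _ _ (by simpa using d)
  have := deriv_nonpos_of_nonneg_left (a := a - b) (b := 0) (by linarith) e (by simp [h0])
    (fun t ht => hz _ ⟨by linarith [ht.2], by linarith [ht.1]⟩)
  linarith

theorem deriv_eq_zero_of_nonneg_interior {z : ℝ → ℝ} {a b c t : ℝ} (ht : t ∈ Ioo a b)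
    (d : HasDerivAt z c t) (h0 : z t = 0) (hz : ∀ t ∈ Icc a b, 0 ≤ z t) : c = 0 :=
  le_antisymm (deriv_nonpos_of_nonneg_left ht.1 d h0 fun s hs => hz s ⟨hs.1, hs.2.trans ht.2.le⟩)
    (deriv_nonneg_of_nonneg_right ht.2 d h0 fun s hs => hz s ⟨ht.1.le.trans hs.1, hs.2⟩)

/-- In a Lipschitz one-parameter family on a compact interval, positivity is lost through a
nonnegative member with a zero. -/
theorem exists_touching {D : ℝ → ℝ → ℝ} {C a b α₀ α₁ : ℝ} (hab : a ≤ b) (hC : 0 ≤ C)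
    (hL : ∀ α β, ∀ t ∈ Icc a b, |D α t - D β t| ≤ C * |α - β|)
    (hc : ∀ α, ContinuousOn (D α) (Icc a b)) (h0 : ∀ t ∈ Icc a b, 0 < D α₀ t)
    (h1 : ∃ t ∈ Icc a b, D α₁ t ≤ 0) :
    ∃ α ∈ uIcc α₀ α₁, (∀ t ∈ Icc a b, 0 ≤ D α t) ∧ ∃ t ∈ Icc a b, D α t = 0 := by
  have hmin := fun α => isCompact_Icc.exists_isMinOn (nonempty_Icc.2 hab) (hc α)
  choose τ hτ hτmin using hmin
  have hm : ∀ α, ∀ t ∈ Icc a b, D α (τ α) ≤ D α t := fun α t ht => hτmin α ht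
  -- The minimum over t inherits the Lipschitz bound in α, so it passes through 0 by the
  -- intermediate value theorem.
  have hlip : ∀ α β, |D α (τ α) - D β (τ β)| ≤ C * |α - β| := by
    intro α β
    have e1 := abs_le.1 (hL α β (τ β) (hτ β))
    have e2 := abs_le.1 (hL α β (τ α) (hτ α))
    have e3 := hm α (τ β) (hτ β)
    have e4 := hm β (τ α) (hτ α)
    rw [abs_le]
    constructor <;> linarith
  have hcont : Continuous fun α => D α (τ α) :=
    (LipschitzWith.of_dist_le_mul (K := ⟨C, hC⟩) fun α β => by
      rw [Real.dist_eq, Real.dist_eq]; exact hlip α β).continuous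
  have hpos := h0 _ (hτ α₀)
  obtain ⟨t₁, ht₁, hle⟩ := h1
  have hneg := (hm α₁ t₁ ht₁).trans hle
  obtain ⟨α, hα, e⟩ := intermediate_value_uIcc (hcont.continuousOn (s := uIcc α₀ α₁))
    (mem_uIcc_of_ge hneg hpos.le)
  exact ⟨α, hα, fun t ht => by simpa [e] using hm α t ht, τ α, hτ α, e⟩

/-! ### The shooting family and its least zero -/

/-- The family of solutions of the truncated equation with `u(0) = α`, `u'(0) = 0`. -/
structure ShootingFamily (k lam : ℝ) (U V : ℝ → ℝ → ℝ) : Prop where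
  hk : 0 < k
  hlam : 0 ≤ lam
  sol : ∀ α, ForcedSol k (truncDuffing lam (lam + 2)) (U α) (V α)
  init : ∀ α, U α 0 = α
  init_deriv : ∀ α, V α 0 = 0

theorem exists_shootingFamily {k lam : ℝ} (hk : 0 < k) (hlam : 0 ≤ lam) : ∃ U V, ShootingFamily k lam U V := by
  have hM : 0 ≤ lam + 2 := by linarith
  set K : NNReal := ⟨k * (3 * (lam + 2) ^ 2 + lam), by positivity⟩ with hK
  have H := fun α => exists_second_order (Φ := fun t x => k * (truncDuffing lam (lam + 2) x + cos t))
    (K := K) (C := k * ((3 * (lam + 2) ^ 2 + lam) * (lam + 2) + 1))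
    (fun x => by fun_prop)
    (fun t => LipschitzWith.of_dist_le_mul fun x y => by
      rw [Real.dist_eq, Real.dist_eq, show k * (truncDuffing lam (lam + 2) x + cos t) -
        k * (truncDuffing lam (lam + 2) y + cos t) =
        k * (truncDuffing lam (lam + 2) x - truncDuffing lam (lam + 2) y) by ring, abs_mul,
        abs_of_pos hk]
      have := mul_le_mul_of_nonneg_left (truncDuffing_lipschitz hlam hM x y) hk.le
      rw [← mul_assoc] at this
      exact this)
    (fun t x => by
      rw [abs_mul, abs_of_pos hk]
      refine mul_le_mul_of_nonneg_left ((abs_add_le _ _).trans ?_) hk.le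
      exact add_le_add (abs_truncDuffing_le hlam hM x) (abs_cos_le_one t)) α
  choose U V h0 h0' hU hV using H
  exact ⟨U, V, hk, hlam, fun α => ⟨hU α, hV α⟩, h0, h0'⟩

namespace ShootingFamily

variable {k lam : ℝ} {U V : ℝ → ℝ → ℝ}

theorem lipschitz (h : ShootingFamily k lam U V) : ∃ C, 0 < C ∧ ∀ α β, ∀ t ∈ Icc 0 π,
    |U α t - U β t| ≤ C * |α - β| ∧ |V α t - V β t| ≤ C * |α - β| := by
  have hk := h.hk
  have hlam := h.hlam
  set K : ℝ := max 1 (k * (3 * (lam + 2) ^ 2 + lam))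
  have hK1 : 1 ≤ K := le_max_left _ _
  refine ⟨exp (K * π), exp_pos _, fun α β t ht => ?_⟩
  have := second_order_gronwall (h := fun s => U α s - U β s) (h1 := fun s => V α s - V β s)
    (h2 := fun s => k * (truncDuffing lam (lam + 2) (U α s) + cos s) -
      k * (truncDuffing lam (lam + 2) (U β s) + cos s)) (K := K) (δ := 0) (A := |α - β|)
    (a := 0) (b := π) hK1 le_rfl
    (fun s _ => ((h.sol α).1 s).sub ((h.sol β).1 s))
    (fun s _ => ((h.sol α).2 s).sub ((h.sol β).2 s))
    (fun s _ => by
      rw [show k * (truncDuffing lam (lam + 2) (U α s) + cos s) -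
        k * (truncDuffing lam (lam + 2) (U β s) + cos s) =
        k * (truncDuffing lam (lam + 2) (U α s) - truncDuffing lam (lam + 2) (U β s)) by ring,
        abs_mul, abs_of_pos hk, add_zero]
      have e := mul_le_mul_of_nonneg_left (truncDuffing_lipschitz (M := lam + 2) hlam
        (by linarith) (U α s) (U β s)) hk.le
      rw [← mul_assoc] at e
      exact e.trans (mul_le_mul_of_nonneg_right (le_max_right _ _) (abs_nonneg _)))
    (by rw [h.init, h.init]) (by simp [h.init_deriv]) t ht
  rw [gronwallBound_ε0, sub_zero] at this
  have e : |α - β| * exp (K * t) ≤ exp (K * π) * |α - β| := by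
    rw [mul_comm]
    exact mul_le_mul_of_nonneg_right (exp_le_exp.2
      (mul_le_mul_of_nonneg_left ht.2 (by linarith))) (abs_nonneg _)
  exact ⟨this.1.trans e, this.2.trans e⟩

theorem continuous_apply (h : ShootingFamily k lam U V) {t : ℝ} (ht : t ∈ Icc 0 π) :
    Continuous (fun α => U α t) ∧ Continuous (fun α => V α t) := by
  obtain ⟨C, hC, H⟩ := h.lipschitz
  exact ⟨(LipschitzWith.of_dist_le_mul (K := ⟨C, hC.le⟩) fun α β => by
    rw [Real.dist_eq, Real.dist_eq]; exact (H α β t ht).1).continuous,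
    (LipschitzWith.of_dist_le_mul (K := ⟨C, hC.le⟩) fun α β => by
    rw [Real.dist_eq, Real.dist_eq]; exact (H α β t ht).2).continuous⟩

/-- The maximum principle applied to the truncated equation keeps |U α| below `lam + 2`, where the
truncation does nothing. -/
theorem neumannSol (h : ShootingFamily k lam U V) {α : ℝ} (hα : V α π = 0) :
    NeumannSol k lam (U α) (V α) := by
  have hlam := h.hlam
  refine ⟨(h.sol α).congr_nonlinearity fun t => ?_, h.init_deriv α, hα⟩
  refine truncDuffing_eq (le_of_lt ?_)
  exact (h.sol α).abs_lt_of_neumann (truncDuffing_locallyLipschitz _ _)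
    (truncDuffing_neg (by linarith)) h.hk (h.init_deriv α) hα
    (fun x hx => one_lt_truncDuffing hlam hx) t

/-- The solution starting below the truncation range is explicit. -/
theorem low (h : ShootingFamily k lam U V) :
    (∀ t, U (-(lam + 3)) t ≤ -(lam + 3)) ∧ V (-(lam + 3)) π < 0 := by
  have hk := h.hk
  have hlam := h.hlam
  set c := duffing lam (lam + 2) with hc
  have hc1 : 1 < c := one_lt_duffing hlam le_rfl
  -- Below -(lam+2) the frozen nonlinearity is the constant -c, and y integrates y'' = k(cos t - c).
  -- As c > 1, the bound 1 - t²/2 ≤ cos t keeps y in that range.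
  set y : ℝ → ℝ := fun t => -(lam + 3) + k * (-c * t ^ 2 / 2 + 1 - cos t) with hy
  have hyle : ∀ t, y t ≤ -(lam + 3) := fun t => by
    have := one_sub_sq_div_two_le_cos (x := t)
    have h2 : -c * t ^ 2 / 2 + 1 - cos t ≤ 0 := by nlinarith [sq_nonneg t]
    have := mul_nonpos_of_nonneg_of_nonpos hk.le h2
    simp only [hy]
    linarith
  have hsol : ForcedSol k (truncDuffing lam (lam + 2)) y (fun t => k * (-c * t + sin t)) := by
    constructor
    · intro t
      have e := ((((((hasDerivAt_id t).fun_pow 2).const_mul (-c)).div_const 2).add_const 1).fun_sub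
        (hasDerivAt_cos t)).const_mul k |>.const_add (-(lam + 3))
      refine e.congr_deriv ?_
      simp only [id]
      push_cast
      ring
    · intro t
      have e := (((hasDerivAt_id t).const_mul (-c)).fun_add (hasDerivAt_sin t)).const_mul k
      refine e.congr_deriv ?_
      have e1 : truncDuffing lam (lam + 2) (-y t) = c := by
        rw [truncDuffing, clamp_of_le (by linarith) (by linarith [hyle t])]
      rw [truncDuffing_neg (by linarith)] at e1
      rw [← e1]
      ring
  have e := hsol.unique (truncDuffing_locallyLipschitz _ _) (h.sol (-(lam + 3))) (t₀ := 0)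
    (by simp [hy, h.init]) (by simp [h.init_deriv])
  refine ⟨fun t => by rw [← (e t).1]; exact hyle t, ?_⟩
  rw [← (e π).2]
  simp only [sin_pi, add_zero]
  have := mul_pos hk (mul_pos (by linarith : 0 < c) pi_pos)
  linarith

/-- The least Neumann zero of the shooting function. -/
theorem exists_minimal (h : ShootingFamily k lam U V) {β : ℝ} (hβ : V β π = 0) :
    ∃ α, V α π = 0 ∧ -(lam + 3) < α ∧ ∀ γ ∈ Ico (-(lam + 3)) α, V γ π < 0 := by
  have hcont := (h.continuous_apply ⟨pi_pos.le, le_rfl⟩).2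
  have hlow := h.low
  have hβ' : -(lam + 3) < β := by
    have := abs_lt.1 ((h.neumannSol hβ).abs_lt h.hk h.hlam 0)
    rw [h.init] at this
    linarith [this.1]
  have hcomp : IsCompact ({γ | V γ π = 0} ∩ Icc (-(lam + 3)) β) :=
    (isCompact_Icc).inter_left (isClosed_eq hcont continuous_const)
  obtain ⟨α, hα, hmin⟩ := hcomp.exists_isLeast ⟨β, hβ, hβ'.le, le_rfl⟩
  have hlt : -(lam + 3) < α := by
    refine lt_of_le_of_ne hα.2.1 fun e => ?_
    have := hα.1
    rw [mem_ofPred_eq, ← e] at this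
    linarith
  refine ⟨α, hα.1, hlt, fun γ hγ => ?_⟩
  by_contra hge
  push Not at hge
  obtain ⟨δ, hδ, e⟩ := intermediate_value_Icc hγ.1 hcont.continuousOn ⟨hlow.2.le, hge⟩
  have := hmin ⟨e, hδ.1, (hδ.2.trans hγ.2.le).trans hα.2.2⟩
  linarith [hδ.2, hγ.2]

/-- Sliding up to a supersolution. -/
theorem slide (h : ShootingFamily k lam U V) {α₁ : ℝ} (hneg : ∀ γ ∈ Ico (-(lam + 3)) α₁, V γ π < 0)
    {σ σ1 σ2 : ℝ → ℝ} (d1 : ∀ t ∈ Icc 0 π, HasDerivAt σ (σ1 t) t)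
    (d2 : ∀ t ∈ Icc 0 π, HasDerivAt σ1 (σ2 t) t)
    (hsup : ∀ t ∈ Icc 0 π, σ2 t ≤ k * (duffing lam (σ t) + cos t))
    (hσ : ∀ t ∈ Icc 0 π, |σ t| ≤ lam + 2) (h0 : σ1 0 = 0) (hπ : σ1 π = 0) :
    ∀ γ ∈ Ico (-(lam + 3)) α₁, ∀ t ∈ Icc 0 π, U γ t < σ t := by
  intro γ hγ t ht
  by_contra hge
  push Not at hge
  have hk := h.hk
  have hlam := h.hlam
  have hpi := pi_pos
  obtain ⟨C, hC, HC⟩ := h.lipschitz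
  obtain ⟨α, hα, hnn, s, hs, hs0⟩ := exists_touching (D := fun α t => σ t - U α t) (C := C)
    (α₀ := -(lam + 3)) (α₁ := γ) hpi.le hC.le
    (fun α β t ht => by
      rw [show σ t - U α t - (σ t - U β t) = -(U α t - U β t) by ring, abs_neg]
      exact (HC α β t ht).1)
    (fun α t ht => ((d1 t ht).continuousAt.sub (h.sol α).continuous.continuousAt).continuousWithinAt)
    (fun t ht => by linarith [h.low.1 t, (abs_le.1 (hσ t ht)).1]) ⟨t, ht, by linarith⟩
  rw [uIcc_of_le hγ.1] at hα
  have hαneg := hneg α ⟨hα.1, hα.2.trans_lt hγ.2⟩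
  have dz1 : ∀ t ∈ Icc 0 π, HasDerivAt (fun t => σ t - U α t) (σ1 t - V α t) t :=
    fun t ht => (d1 t ht).sub ((h.sol α).1 t)
  -- A touching point before π is a double zero, because both slopes vanish at 0, and comparison
  -- spreads it to π. At π the gap has slope -V α π > 0, impossible for a nonnegative function
  -- vanishing there.
  have hzpi : σ π - U α π = 0 := by
    rcases eq_or_lt_of_le hs.2 with e | hlt
    · rwa [e] at hs0
    · have hs1 : σ1 s - V α s = 0 := by
        rcases eq_or_lt_of_le hs.1 with e | hgt
        · rw [← e, h0, h.init_deriv, sub_zero]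
        · exact deriv_eq_zero_of_nonneg_interior ⟨hgt, hlt⟩ (dz1 s hs) hs0 hnn
      refine eq_zero_of_deriv2_le (z2 := fun t => σ2 t - k * (truncDuffing lam (lam + 2) (U α t) +
        cos t)) (K := k * (3 * (lam + 2) ^ 2 + lam)) hs dz1
        (fun t ht => (d2 t ht).sub ((h.sol α).2 t)) ?_ hnn hs0 hs1 π ⟨hpi.le, le_rfl⟩
      intro t ht
      have e1 := hsup t ht
      rw [← truncDuffing_eq (hσ t ht)] at e1
      have e2 := (le_abs_self _).trans
        (truncDuffing_lipschitz (M := lam + 2) hlam (by linarith) (σ t) (U α t))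
      rw [abs_of_nonneg (hnn t ht)] at e2
      have e3 := mul_le_mul_of_nonneg_left e2 hk.le
      linarith
  have := deriv_nonpos_of_nonneg_left hpi (dz1 π ⟨hpi.le, le_rfl⟩) hzpi hnn
  rw [hπ] at this
  linarith

theorem le_of_supersolution (h : ShootingFamily k lam U V) {α₁ : ℝ} (hα₁ : -(lam + 3) < α₁)
    (hneg : ∀ γ ∈ Ico (-(lam + 3)) α₁, V γ π < 0)
    {σ σ1 σ2 : ℝ → ℝ} (d1 : ∀ t ∈ Icc 0 π, HasDerivAt σ (σ1 t) t)
    (d2 : ∀ t ∈ Icc 0 π, HasDerivAt σ1 (σ2 t) t)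
    (hsup : ∀ t ∈ Icc 0 π, σ2 t ≤ k * (duffing lam (σ t) + cos t))
    (hσ : ∀ t ∈ Icc 0 π, |σ t| ≤ lam + 2) (h0 : σ1 0 = 0) (hπ : σ1 π = 0) :
    ∀ t ∈ Icc 0 π, U α₁ t ≤ σ t := by
  intro t ht
  have hc := (h.continuous_apply ht).1.continuousWithinAt (s := Iio α₁) (x := α₁)
  refine le_of_tendsto hc ?_
  filter_upwards [Ico_mem_nhdsLT hα₁] with γ hγ
  exact (h.slide hneg d1 d2 hsup hσ h0 hπ γ hγ t ht).le

/-- Every Neumann solution is a supersolution, so the least initial value belongs to the pointwise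
least solution. -/
theorem le_of_neumannSol (h : ShootingFamily k lam U V) {α₁ : ℝ} (hα₁ : -(lam + 3) < α₁)
    (hneg : ∀ γ ∈ Ico (-(lam + 3)) α₁, V γ π < 0) {u v : ℝ → ℝ} (hu : NeumannSol k lam u v) :
    ∀ t ∈ Icc 0 π, U α₁ t ≤ u t :=
  h.le_of_supersolution hα₁ hneg (fun t _ => hu.1.1 t) (fun t _ => hu.1.2 t)
    (fun _ _ => le_rfl) (fun t _ => (hu.abs_lt h.hk h.hlam t).le) hu.2.1 hu.2.2

end ShootingFamily

/-! ### The linearized equation -/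

/-- The solution `z` (with derivative `z1`) on `[0, π]` of the equation linearized at `u`,
normalized by `z(0) = 1`, `z'(0) = 0`. -/
structure Linearized (k lam : ℝ) (u z z1 : ℝ → ℝ) : Prop where
  init : z 0 = 1
  init_deriv : z1 0 = 0
  d1 : ∀ t ∈ Icc 0 π, HasDerivAt z (z1 t) t
  d2 : ∀ t ∈ Icc 0 π, HasDerivAt z1 (k * (3 * u t ^ 2 - lam) * z t) t

theorem abs_clamp_le_abs {B : ℝ} (hB : 0 ≤ B) (x : ℝ) : |clamp B x| ≤ |x| := by
  have h := (clamp_lipschitz B).dist_le_mul x 0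
  rw [clamp_eq (x := 0) (by simpa using hB)] at h
  simpa [Real.dist_eq] using h

theorem potential_bound {k lam M x : ℝ} (hk : 0 < k) (hlam : 0 ≤ lam) (hx : |x| ≤ M) :
    |k * (3 * x ^ 2 - lam)| ≤ k * (3 * M ^ 2 + lam) := by
  have h : x ^ 2 ≤ M ^ 2 := sq_le_sq' (abs_le.1 hx).1 (abs_le.1 hx).2
  rw [abs_mul, abs_of_pos hk]
  refine mul_le_mul_of_nonneg_left (abs_le.2 ⟨?_, ?_⟩) hk.le <;> nlinarith [sq_nonneg x]

namespace NeumannSol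

variable {k lam : ℝ} {u v z z1 : ℝ → ℝ}

/-- The global existence theorem needs a bounded right side, so z is clamped at its own Grönwall
bound B; the clamp is inactive on [0, π]. -/
theorem exists_linearized (hk : 0 < k) (hlam : 0 ≤ lam) (h : NeumannSol k lam u v) :
    ∃ z z1, Linearized k lam u z z1 := by
  set P : ℝ := k * (3 * (lam + 2) ^ 2 + lam) with hP
  have hP0 : 0 ≤ P := by positivity
  have hpot : ∀ t, |k * (3 * u t ^ 2 - lam)| ≤ P :=
    fun t => potential_bound hk hlam (h.abs_lt hk hlam t).le
  set K : ℝ := max 1 P with hK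
  have hK1 : 1 ≤ K := le_max_left _ _
  set B : ℝ := exp (K * π) with hB
  have hB0 : 0 ≤ B := (exp_pos _).le
  have hcont := h.1.continuous
  obtain ⟨z, z1, h0, h0', d1, d2⟩ := exists_second_order
    (Φ := fun t x => k * (3 * u t ^ 2 - lam) * clamp B x) (K := ⟨P, hP0⟩) (C := P * B)
    (fun x => by fun_prop)
    (fun t => LipschitzWith.of_dist_le_mul fun x y => by
      rw [Real.dist_eq, Real.dist_eq, ← mul_sub, abs_mul]
      refine mul_le_mul (hpot t) ?_ (abs_nonneg _) hP0
      simpa [Real.dist_eq] using (clamp_lipschitz B).dist_le_mul x y)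
    (fun t x => by
      rw [abs_mul]
      exact mul_le_mul (hpot t) (abs_clamp_le hB0 x) (abs_nonneg _) hP0) 1
  have hz : ∀ t ∈ Icc 0 π, |z t| ≤ B := by
    intro t ht
    have := (second_order_gronwall (δ := 0) (A := 1) (a := 0) (b := π) hK1 le_rfl
      (fun s _ => d1 s) (fun s _ => d2 s)
      (fun s _ => by
        rw [abs_mul, add_zero]
        exact mul_le_mul ((hpot s).trans (le_max_right _ _)) (abs_clamp_le_abs hB0 _)
          (abs_nonneg _) (by linarith)) (by simp [h0]) (by simp [h0']) t ht).1
    rw [gronwallBound_ε0, sub_zero, one_mul] at this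
    exact this.trans (exp_le_exp.2 (mul_le_mul_of_nonneg_left ht.2 (by linarith)))
  refine ⟨z, z1, h0, h0', fun t _ => d1 t, fun t ht => ?_⟩
  have := d2 t
  rwa [clamp_eq (hz t ht)] at this

theorem hasDerivAt_deriv2 (h : NeumannSol k lam u v) (t : ℝ) :
    HasDerivAt (fun t => k * (duffing lam (u t) + cos t))
      (k * ((3 * u t ^ 2 - lam) * v t - sin t)) t := by
  have e := ((((h.1.1 t).fun_pow 3).fun_sub ((h.1.1 t).const_mul lam)).fun_add
    (hasDerivAt_cos t)).const_mul k
  refine e.congr_deriv ?_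
  push_cast
  ring

/-- The velocity v solves the linearized equation with the extra forcing -k sin t, and only this
forcing survives in the Wronskian of v and z. -/
theorem hasDerivAt_wronskian (h : NeumannSol k lam u v) (hz : Linearized k lam u z z1) {t : ℝ}
    (ht : t ∈ Icc 0 π) : HasDerivAt (fun t => k * (duffing lam (u t) + cos t) * z t - z1 t * v t)
      (-(k * sin t * z t)) t := by
  refine (((h.hasDerivAt_deriv2 t).fun_mul (hz.d1 t ht)).fun_sub
    ((hz.d2 t ht).fun_mul (h.1.2 t))).congr_deriv ?_
  ring

theorem wronskian_strictAnti (hk : 0 < k) (h : NeumannSol k lam u v)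
    (hz : Linearized k lam u z z1) {b : ℝ} (hb : b ≤ π) (hpos : ∀ t ∈ Icc 0 b, 0 < z t) :
    StrictAntiOn (fun t => k * (duffing lam (u t) + cos t) * z t - z1 t * v t) (Icc 0 b) := by
  refine strictAntiOn_Icc_of_hasDerivAt
    (fun t ht => h.hasDerivAt_wronskian hz ⟨ht.1, ht.2.trans hb⟩) fun t ht => ?_
  have h1 := sin_pos_of_pos_of_lt_pi ht.1 (ht.2.trans_le hb)
  have h2 := hpos t (Ioo_subset_Icc_self ht)
  have := mul_pos (mul_pos hk h1) h2
  linarith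

/-- Stability gives monotonicity: a positive z makes the Wronskian of v and z strictly decreasing,
and v is nonnegative at both ends. -/
theorem deriv_pos_of_linearized_pos (hk : 0 < k) (h : NeumannSol k lam u v)
    (hz : Linearized k lam u z z1) {b : ℝ} (hb : b ≤ π) (hpos : ∀ t ∈ Icc 0 b, 0 < z t)
    (hvb : 0 ≤ v b) : ∀ t ∈ Ioo 0 b, 0 < v t :=
  pos_of_wronskian_strictAnti (fun t _ => h.1.2 t) (fun t ht => hz.d1 t ⟨ht.1, ht.2.trans hb⟩)
    hpos (h.wronskian_strictAnti hk hz hb hpos) h.2.1 hvb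

/-- A zero of a nonnegative z would be a double zero (at π by the sign of z1), and uniqueness would
contradict z 0 = 1. -/
theorem linearized_pos (hk : 0 < k) (hlam : 0 ≤ lam) (h : NeumannSol k lam u v)
    (hz : Linearized k lam u z z1) (hnn : ∀ t ∈ Icc 0 π, 0 ≤ z t) (hπ : 0 ≤ z1 π) :
    ∀ t ∈ Icc 0 π, 0 < z t := by
  intro t ht
  refine lt_of_le_of_ne (hnn t ht) fun e => ?_
  have hz1 : z1 t = 0 := by
    rcases eq_or_lt_of_le ht.1 with e0 | hlt
    · rw [← e0, hz.init_deriv]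
    · have h1 := deriv_nonpos_of_nonneg_left hlt (hz.d1 t ht) e.symm
        fun s hs => hnn s ⟨hs.1, hs.2.trans ht.2⟩
      rcases eq_or_lt_of_le ht.2 with e0 | hlt'
      · rw [e0] at h1 ⊢
        exact le_antisymm h1 hπ
      · exact deriv_eq_zero_of_nonneg_interior ⟨hlt, hlt'⟩ (hz.d1 t ht) e.symm hnn
  have := (eq_zero_of_second_order ht hz.d1 hz.d2 (fun s _ => by
    rw [abs_mul]
    exact mul_le_mul_of_nonneg_right (potential_bound hk hlam (h.abs_lt hk hlam s).le)
      (abs_nonneg _)) e.symm hz1 0 ⟨le_rfl, pi_pos.le⟩).1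
  rw [hz.init] at this
  norm_num at this

end NeumannSol

/-! ### First-order behaviour of the shooting function at a zero -/

namespace ShootingFamily

variable {k lam : ℝ} {U V : ℝ → ℝ → ℝ}

/-- First-order expansion of the shooting family at a Neumann solution. -/
theorem expansion (h : ShootingFamily k lam U V) {α : ℝ} (hα : V α π = 0) {z z1 : ℝ → ℝ}
    (hz : Linearized k lam (U α) z z1) : ∃ η > 0, ∃ C > 0, ∀ γ, |γ - α| ≤ η → ∀ t ∈ Icc 0 π,
      |U γ t - U α t - (γ - α) * z t| ≤ C * |γ - α| ^ 2 ∧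
      |V γ t - V α t - (γ - α) * z1 t| ≤ C * |γ - α| ^ 2 := by
  have hk := h.hk
  have hlam := h.hlam
  have hN := h.neumannSol hα
  have hub := fun t => hN.abs_lt hk hlam t
  obtain ⟨C, hC, HC⟩ := h.lipschitz
  obtain ⟨s, hs, hmax⟩ := isCompact_Icc.exists_isMaxOn (nonempty_Icc.2 pi_pos.le)
    ((continuous_abs.comp hN.1.continuous).continuousOn (s := Icc 0 π))
  have hsM := hub s
  set P : ℝ := k * (3 * (lam + 2) ^ 2 + lam) with hP
  set K : ℝ := max 1 P with hK
  have hK1 : 1 ≤ K := le_max_left _ _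
  -- Within this η the Lipschitz bound keeps U γ in the untruncated range. There the Taylor
  -- remainder of the cubic is exactly (U γ + 2 U α)(U γ - U α)².
  refine ⟨(lam + 2 - |U α s|) / C, div_pos (by linarith) hC,
    k * (3 * (lam + 2)) * C ^ 2 * exp (K * π), by positivity, fun γ hγ t ht => ?_⟩
  have hCγ : C * |γ - α| ≤ lam + 2 - |U α s| := by
    rw [le_div_iff₀ hC] at hγ
    linarith
  have hγb : ∀ t ∈ Icc 0 π, |U γ t| ≤ lam + 2 := fun t ht => by
    have e1 := (HC γ α t ht).1
    have e2 : |U α t| ≤ |U α s| := hmax ht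
    have e3 := abs_add_le (U γ t - U α t) (U α t)
    rw [sub_add_cancel] at e3
    linarith
  set δ : ℝ := k * (3 * (lam + 2)) * (C * |γ - α|) ^ 2 with hδ
  have hδ0 : 0 ≤ δ := by positivity
  have g := second_order_gronwall (h := fun t => U γ t - U α t - (γ - α) * z t)
    (h1 := fun t => V γ t - V α t - (γ - α) * z1 t)
    (h2 := fun t => k * (truncDuffing lam (lam + 2) (U γ t) + cos t) -
      k * (truncDuffing lam (lam + 2) (U α t) + cos t) -
      (γ - α) * (k * (3 * U α t ^ 2 - lam) * z t)) (K := K) (δ := δ) (A := 0) (a := 0) (b := π)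
    hK1 hδ0
    (fun s hs => (((h.sol γ).1 s).fun_sub ((h.sol α).1 s)).fun_sub ((hz.d1 s hs).const_mul _))
    (fun s hs => (((h.sol γ).2 s).fun_sub ((h.sol α).2 s)).fun_sub ((hz.d2 s hs).const_mul _))
    (fun s hs => by
      have hγs := hγb s hs
      rw [truncDuffing_eq hγs, truncDuffing_eq (hub s).le]
      have e : k * (duffing lam (U γ s) + cos s) - k * (duffing lam (U α s) + cos s) -
          (γ - α) * (k * (3 * U α s ^ 2 - lam) * z s) =
          k * (3 * U α s ^ 2 - lam) * (U γ s - U α s - (γ - α) * z s) +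
          k * (U γ s + 2 * U α s) * (U γ s - U α s) ^ 2 := by
        unfold duffing
        ring
      rw [e]
      refine (abs_add_le _ _).trans (add_le_add ?_ ?_)
      · rw [abs_mul]
        exact mul_le_mul_of_nonneg_right ((potential_bound hk hlam (hub s).le).trans
          (le_max_right _ _)) (abs_nonneg _)
      · rw [abs_mul, abs_mul, abs_of_pos hk, abs_pow]
        have b1 : |U γ s + 2 * U α s| ≤ 3 * (lam + 2) := by
          have := abs_le.1 hγs
          have := abs_le.1 (hub s).le
          rw [abs_le]
          constructor <;> linarith
        have b2 := pow_le_pow_left₀ (abs_nonneg _) (HC γ α s hs).1 2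
        exact mul_le_mul (mul_le_mul_of_nonneg_left b1 hk.le) b2 (by positivity) (by positivity))
    (by simp [h.init, hz.init]) (by simp [h.init_deriv, hz.init_deriv]) t ht
  have hb : gronwallBound 0 K δ (t - 0) ≤ k * (3 * (lam + 2)) * C ^ 2 * exp (K * π) *
      |γ - α| ^ 2 := by
    rw [gronwallBound_of_K_ne_0 (by linarith)]
    simp only [zero_mul, zero_add, sub_zero]
    have e1 : δ / K ≤ δ := div_le_self hδ0 hK1
    have e2 : exp (K * t) - 1 ≤ exp (K * π) := by
      have := exp_le_exp.2 (mul_le_mul_of_nonneg_left ht.2 (by linarith : 0 ≤ K))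
      linarith
    have e3 : 0 ≤ exp (K * t) - 1 := by
      have := one_le_exp (mul_nonneg (by linarith : 0 ≤ K) ht.1)
      linarith
    calc δ / K * (exp (K * t) - 1) ≤ δ * exp (K * π) :=
          mul_le_mul e1 e2 e3 hδ0
      _ = _ := by rw [hδ]; ring
  exact ⟨g.1.trans hb, g.2.trans hb⟩

/-- If nearby members from below stay below, the linearization is nonnegative. -/
theorem linearized_nonneg (h : ShootingFamily k lam U V) {α α₀ : ℝ} (hα : V α π = 0)
    {z z1 : ℝ → ℝ} (hz : Linearized k lam (U α) z z1) (hα₀ : α₀ < α)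
    (hle : ∀ γ ∈ Ico α₀ α, (∀ t ∈ Icc 0 π, U γ t ≤ U α t) ∧ V γ π ≤ 0) :
    (∀ t ∈ Icc 0 π, 0 ≤ z t) ∧ 0 ≤ z1 π := by
  obtain ⟨η, hη, C, hC, H⟩ := h.expansion hα hz
  have key : ∀ (a : ℝ) (b : ℝ → ℝ), (∀ γ ∈ Ico α₀ α, |γ - α| ≤ η →
      |b γ - (γ - α) * a| ≤ C * |γ - α| ^ 2 ∧ b γ ≤ 0) → 0 ≤ a := by
    intro a b hb
    by_contra hneg
    push Not at hneg
    -- With a < 0 this s makes the error C s² at most half of -s a, so b (α - s) would be positive.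
    set s : ℝ := min (min η (α - α₀)) (-a / (2 * C)) with hs
    have hs0 : 0 < s := lt_min (lt_min hη (by linarith)) (div_pos (by linarith) (by linarith))
    have hs1 : s ≤ η := (min_le_left _ _).trans (min_le_left _ _)
    have hs2 : s ≤ α - α₀ := (min_le_left _ _).trans (min_le_right _ _)
    have hs3 : s ≤ -a / (2 * C) := min_le_right _ _
    rw [le_div_iff₀ (by linarith)] at hs3
    have := hb (α - s) ⟨by linarith, by linarith⟩ (by
      rw [show α - s - α = -s by ring, abs_neg, abs_of_pos hs0]; exact hs1)
    rw [show α - s - α = -s by ring, abs_neg, abs_of_pos hs0] at this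
    have h1 := (abs_le.1 this.1).1
    nlinarith [this.2]
  refine ⟨fun t ht => key (z t) (fun γ => U γ t - U α t) fun γ hγ hγ' => ⟨(H γ hγ' t ht).1, ?_⟩,
    key (z1 π) (fun γ => V γ π - V α π) fun γ hγ hγ' =>
      ⟨(H γ hγ' π ⟨pi_pos.le, le_rfl⟩).2, ?_⟩⟩
  · linarith [(hle γ hγ).1 t ht]
  · linarith [(hle γ hγ).2]

theorem shooting_pos_right (h : ShootingFamily k lam U V) {α : ℝ} (hα : V α π = 0)
    {z z1 : ℝ → ℝ} (hz : Linearized k lam (U α) z z1) (hπ : 0 < z1 π) :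
    ∃ η > 0, ∀ γ ∈ Ioo α (α + η), 0 < V γ π := by
  obtain ⟨η, hη, C, hC, H⟩ := h.expansion hα hz
  refine ⟨min η (z1 π / C), lt_min hη (div_pos hπ hC), fun γ hγ => ?_⟩
  have hp : 0 < γ - α := by linarith [hγ.1]
  have e1 : γ - α < η := by linarith [hγ.2, min_le_left η (z1 π / C)]
  have e2 : γ - α < z1 π / C := by linarith [hγ.2, min_le_right η (z1 π / C)]
  rw [lt_div_iff₀ hC] at e2
  have := (H γ (by rw [abs_of_pos hp]; exact e1.le) π ⟨pi_pos.le, le_rfl⟩).2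
  rw [abs_of_pos hp, hα] at this
  nlinarith [(abs_le.1 this).1]

theorem shooting_neg_left (h : ShootingFamily k lam U V) {α : ℝ} (hα : V α π = 0)
    {z z1 : ℝ → ℝ} (hz : Linearized k lam (U α) z z1) (hpos : ∀ t ∈ Icc 0 π, 0 < z t)
    (hπ : 0 < z1 π) :
    ∃ η > 0, ∀ γ ∈ Ioo (α - η) α, V γ π < 0 ∧ ∀ t ∈ Icc 0 π, U γ t < U α t := by
  obtain ⟨η, hη, C, hC, H⟩ := h.expansion hα hz
  obtain ⟨s, hs, hmin⟩ := isCompact_Icc.exists_isMinOn (nonempty_Icc.2 pi_pos.le)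
    (fun t ht => (hz.d1 t ht).continuousAt.continuousWithinAt : ContinuousOn z (Icc 0 π))
  set m := min (z1 π) (z s) with hm
  have hm0 : 0 < m := lt_min hπ (hpos s hs)
  refine ⟨min η (m / C), lt_min hη (div_pos hm0 hC), fun γ hγ => ?_⟩
  have hp : 0 < α - γ := by linarith [hγ.2]
  have e1 : α - γ < η := by linarith [hγ.1, min_le_left η (m / C)]
  have e2 : α - γ < m / C := by linarith [hγ.1, min_le_right η (m / C)]
  rw [lt_div_iff₀ hC] at e2
  have e3 : |γ - α| = α - γ := by rw [abs_sub_comm, abs_of_pos hp]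
  have HH := fun t ht => H γ (by rw [e3]; exact e1.le) t ht
  rw [e3] at HH
  constructor
  · have := (abs_le.1 (HH π ⟨pi_pos.le, le_rfl⟩).2).2
    rw [hα] at this
    have : m ≤ z1 π := min_le_left _ _
    nlinarith
  · intro t ht
    have := (abs_le.1 (HH t ht).1).2
    have : m ≤ z t := (min_le_right _ _).trans (hmin ht)
    nlinarith

end ShootingFamily

/-! ### The odd solution and its uniform stability -/

/-- A Neumann solution, antisymmetric about `π / 2` and negative on `[0, π / 2)`. -/
structure OddSol (k lam : ℝ) (p q : ℝ → ℝ) : Prop where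
  sol : NeumannSol k lam p q
  mid : p (π / 2) = 0
  neg : ∀ t ∈ Ico 0 (π / 2), p t < 0
  odd : ∀ t, p (π - t) = -p t

/-- Raise the initial value until the graph touches 0 from below on [0, π/2]. A touch before π/2 is
critical and has acceleration k cos t > 0, so the touch is at π/2. Oddness of the equation about π/2
then transports v(0) = 0 to π. -/
theorem ShootingFamily.exists_oddSol {k lam : ℝ} {U V : ℝ → ℝ → ℝ}
    (h : ShootingFamily k lam U V) : ∃ α, OddSol k lam (U α) (V α) := by
  have hk := h.hk
  have hlam := h.hlam
  have hpi := pi_pos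
  obtain ⟨C, hC, HC⟩ := h.lipschitz
  obtain ⟨α, hα, hnn, s, hs, hs0⟩ := exists_touching (D := fun α t => -U α t) (C := C)
    (a := 0) (b := π / 2) (α₀ := -(lam + 3)) (α₁ := 0) (by linarith) hC.le
    (fun α β t ht => by
      rw [show -U α t - -U β t = -(U α t - U β t) by ring, abs_neg]
      exact (HC α β t ⟨ht.1, by linarith [ht.2]⟩).1)
    (fun α => (h.sol α).continuous.neg.continuousOn)
    (fun t _ => by linarith [h.low.1 t]) ⟨0, ⟨le_rfl, by linarith⟩, by simp [h.init]⟩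
  have htr0 : truncDuffing lam (lam + 2) 0 = 0 := by
    rw [truncDuffing_eq (by simp; linarith)]; simp [duffing]
  have hneg : ∀ t ∈ Ico 0 (π / 2), U α t < 0 := by
    intro t ht
    have hle := hnn t (Ico_subset_Icc_self ht)
    refine lt_of_le_of_ne (by linarith) fun e => ?_
    have hv : V α t = 0 := by
      rcases eq_or_lt_of_le ht.1 with e0 | hgt
      · rw [← e0, h.init_deriv]
      · have := deriv_eq_zero_of_nonneg_interior ⟨hgt, ht.2⟩ ((h.sol α).1 t).fun_neg (by simp [e]) hnn
        linarith
    obtain ⟨δ, hδ, H⟩ := exists_lt_right_of_deriv2_pos (h.sol α).1 ((h.sol α).2 t) hv (by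
      rw [e, htr0, zero_add]
      exact mul_pos hk (cos_pos_of_mem_Ioo ⟨by linarith [ht.1], ht.2⟩))
    have hm : 0 < min δ (π / 2 - t) := lt_min hδ (by linarith [ht.2])
    have h1 := H (t + min δ (π / 2 - t)) ⟨by linarith, by linarith [min_le_left δ (π / 2 - t)]⟩
    have h2 := hnn (t + min δ (π / 2 - t)) ⟨by linarith [ht.1],
      by linarith [min_le_right δ (π / 2 - t)]⟩
    linarith
  have hmid : U α (π / 2) = 0 := by
    rcases eq_or_lt_of_le hs.2 with e | hlt
    · rw [e] at hs0
      linarith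
    · linarith [hneg s ⟨hs.1, hlt⟩]
  have hp2 : π - π / 2 = π / 2 := by ring
  have hodd := ((h.sol α).neg_reflect (truncDuffing_neg (by linarith))).unique
    (truncDuffing_locallyLipschitz _ _) (h.sol α) (t₀ := π / 2) (by simp [hp2, hmid]) (by rw [hp2])
  have hVπ : V α π = 0 := by
    have := (hodd 0).2
    rwa [sub_zero, h.init_deriv] at this
  exact ⟨α, h.neumannSol hVπ, hmid, hneg, fun t => by linarith [(hodd t).1]⟩

namespace OddSol

variable {k lam : ℝ} {p q z z1 : ℝ → ℝ}

/-- Here p itself is compared with z. The defect cos t - 2p³ is positive as long as p < 0 and t <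
π/2, without any stability input. -/
theorem hasDerivAt_wronskian_self (h : OddSol k lam p q) (hz : Linearized k lam p z z1) {t : ℝ}
    (ht : t ∈ Icc 0 π) : HasDerivAt (fun t => q t * z t - z1 t * p t)
      (k * z t * (cos t - 2 * p t ^ 3)) t := by
  refine (((h.sol.1.2 t).fun_mul (hz.d1 t ht)).fun_sub
    ((hz.d2 t ht).fun_mul (h.sol.1.1 t))).congr_deriv ?_
  unfold duffing
  ring

theorem wronskian_self_strictMono (hk : 0 < k) (h : OddSol k lam p q)
    (hz : Linearized k lam p z z1) {τ : ℝ} (hτ : τ ≤ π / 2) (hpos : ∀ t ∈ Ioo 0 τ, 0 < z t) :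
    StrictMonoOn (fun t => q t * z t - z1 t * p t) (Icc 0 τ) := by
  have hpi := pi_pos
  refine strictMonoOn_Icc_of_hasDerivAt (fun t ht => h.hasDerivAt_wronskian_self hz
    ⟨ht.1, by linarith [ht.2]⟩) fun t ht => ?_
  have h1 := h.neg t ⟨ht.1.le, ht.2.trans_le hτ⟩
  have h2 := cos_pos_of_mem_Ioo (x := t) ⟨by linarith [ht.1], ht.2.trans_le hτ⟩
  have h3 : p t ^ 3 < 0 := Odd.pow_neg (by decide) h1
  exact mul_pos (mul_pos hk (hpos t ht)) (by linarith)

/-- At a first zero τ of z the Wronskian equals -z1 τ · p τ ≤ 0, although it has increased strictly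
from 0. -/
theorem linearized_pos_half (hk : 0 < k) (h : OddSol k lam p q) (hz : Linearized k lam p z z1) :
    ∀ t ∈ Icc 0 (π / 2), 0 < z t := by
  have hpi := pi_pos
  intro t ht
  by_contra hneg
  push Not at hneg
  have hcz : ContinuousOn z (Icc 0 (π / 2)) := fun t ht =>
    (hz.d1 t ⟨ht.1, by linarith [ht.2]⟩).continuousAt.continuousWithinAt
  have hcomp : IsCompact (Icc 0 (π / 2) ∩ z ⁻¹' Iic 0) :=
    isCompact_Icc.of_isClosed_subset (hcz.preimage_isClosed_of_isClosed isClosed_Icc isClosed_Iic)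
      inter_subset_left
  obtain ⟨τ, ⟨hτ, hτz⟩, hmin⟩ := hcomp.exists_isLeast ⟨t, ht, hneg⟩
  have hτz : z τ ≤ 0 := hτz
  have hpos : ∀ s ∈ Ico 0 τ, 0 < z s := fun s hs => by
    by_contra hle
    push Not at hle
    have := hmin ⟨⟨hs.1, hs.2.le.trans hτ.2⟩, hle⟩
    linarith [hs.2]
  have hτ0 : 0 < τ := by
    refine lt_of_le_of_ne hτ.1 fun e => ?_
    rw [← e, hz.init] at hτz
    linarith
  have hτπ : τ ∈ Icc 0 π := ⟨hτ.1, by linarith [hτ.2]⟩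
  have hz0 : z τ = 0 := by
    refine le_antisymm hτz ?_
    have hc := (hz.d1 τ hτπ).continuousAt.continuousWithinAt (s := Iio τ)
    refine ge_of_tendsto hc ?_
    filter_upwards [Ico_mem_nhdsLT hτ0] with s hs using (hpos s hs).le
  have hz1 : z1 τ ≤ 0 := deriv_nonpos_of_nonneg_left hτ0 (hz.d1 τ hτπ) hz0 fun s hs => by
    rcases eq_or_lt_of_le hs.2 with e | hlt
    · rw [e, hz0]
    · exact (hpos s ⟨hs.1, hlt⟩).le
  have := h.wronskian_self_strictMono hk hz hτ.2 (fun s hs => hpos s (Ioo_subset_Ico_self hs))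
    ⟨le_rfl, hτ.1⟩ ⟨hτ.1, le_rfl⟩ hτ0
  simp only [h.sol.2.1, hz.init_deriv, hz0, mul_zero, zero_mul, sub_zero, zero_sub] at this
  have hp : p τ ≤ 0 := by
    rcases eq_or_lt_of_le hτ.2 with e | hlt
    · rw [e, h.mid]
    · exact (h.neg τ ⟨hτ.1, hlt⟩).le
  nlinarith [mul_nonneg_of_nonpos_of_nonpos hz1 hp]

theorem deriv_mid_nonneg (h : OddSol k lam p q) : 0 ≤ q (π / 2) := by
  have hpi := pi_pos
  have := deriv_nonpos_of_nonneg_left (a := 0) (b := π / 2) (by linarith)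
    (h.sol.1.1 (π / 2)).fun_neg (by simp [h.mid]) fun t ht => by
      rcases eq_or_lt_of_le ht.2 with e | hlt
      · simp [e, h.mid]
      · linarith [h.neg t ⟨ht.1, hlt⟩]
  linarith

theorem deriv_pos_half (hk : 0 < k) (hlam : 0 ≤ lam) (h : OddSol k lam p q) :
    ∀ t ∈ Ioo 0 (π / 2), 0 < q t := by
  obtain ⟨z, z1, hz⟩ := h.sol.exists_linearized hk hlam
  have hpi := pi_pos
  exact h.sol.deriv_pos_of_linearized_pos hk hz (by linarith) (h.linearized_pos_half hk hz)
    h.deriv_mid_nonneg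

theorem monotoneOn_half (hk : 0 < k) (hlam : 0 ≤ lam) (h : OddSol k lam p q) :
    MonotoneOn p (Icc 0 (π / 2)) :=
  monotoneOn_Icc_of_hasDerivAt (fun t _ => h.sol.1.1 t) fun t ht =>
    (h.deriv_pos_half hk hlam t ht).le

theorem deriv_zero_nonneg (hk : 0 < k) (hlam : 0 ≤ lam) (h : OddSol k lam p q) :
    0 ≤ duffing lam (p 0) + 1 := by
  have hpi := pi_pos
  have := deriv_nonneg_of_nonneg_right (a := 0) (b := π / 4) (by linarith) (h.sol.1.2 0) h.sol.2.1
    fun t ht => by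
      rcases eq_or_lt_of_le ht.1 with e | hlt
      · rw [← e, h.sol.2.1]
      · exact (h.deriv_pos_half hk hlam t ⟨hlt, by linarith [ht.2]⟩).le
  rw [cos_zero] at this
  exact nonneg_of_mul_nonneg_right this hk

/-- A linearized solution dominates the normalized solution itself. -/
theorem le_linearized (hk : 0 < k) (h : OddSol k lam p q) (hz : Linearized k lam p z z1) :
    ∀ t ∈ Icc 0 (π / 2), -p t ≤ -p 0 * z t := by
  have hpi := pi_pos
  intro t ht
  have hzpos := h.linearized_pos_half hk hz
  have hW := h.wronskian_self_strictMono hk hz le_rfl fun s hs => hzpos s (Ioo_subset_Icc_self hs)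
  have hmono : MonotoneOn (fun t => p t / z t) (Icc 0 (π / 2)) := by
    refine monotoneOn_Icc_of_hasDerivAt (fun s hs => (h.sol.1.1 s).fun_div
      (hz.d1 s ⟨hs.1, by linarith [hs.2]⟩) (hzpos s hs).ne') fun s hs => ?_
    have := hW.monotoneOn ⟨le_rfl, by linarith⟩ (Ioo_subset_Icc_self hs) hs.1.le
    simp only [h.sol.2.1, hz.init_deriv, zero_mul, sub_zero] at this
    exact div_nonneg (by linarith) (sq_nonneg _)
  have := hmono ⟨le_rfl, by linarith⟩ ht ht.1
  simp only [hz.init, div_one] at this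
  rw [le_div_iff₀ (hzpos t ht)] at this
  linarith

/-- Away from the transition layer the odd solution is bounded away from zero. -/
theorem sq_lower_bound (hk : 2304 ≤ k) (hlam : 0 ≤ lam) (h : OddSol k lam p q) :
    ∀ t ∈ Icc 0 (π / 4), lam / 2 + 1 / 16 ≤ p t ^ 2 := by
  have hpi := pi_pos
  have hk0 : 0 < k := by linarith
  have hmono := h.monotoneOn_half hk0 hlam
  suffices hq : lam / 2 + 1 / 16 ≤ p (π / 4) ^ 2 by
    intro t ht
    have h1 := hmono ⟨ht.1, by linarith [ht.2]⟩ ⟨by linarith, by linarith⟩ ht.2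
    have h2 := h.neg (π / 4) ⟨by linarith, by linarith⟩
    nlinarith
  by_contra hlt
  push Not at hlt
  -- Sturm comparison: one arch of this sine fits [π/4, π/3] exactly. If the bound failed, p'' ≥ 144
  -- (-p) there (2304 = 16 · 144), so the positive function -p would have to vanish.
  set s : ℝ → ℝ := fun t => sin (12 * (t - π / 4)) with hs
  set c : ℝ → ℝ := fun t => cos (12 * (t - π / 4)) with hc
  have ds : ∀ t, HasDerivAt s (12 * c t) t := fun t => by
    have := (((hasDerivAt_id t).sub_const (π / 4)).const_mul 12).sin
    refine this.congr_deriv ?_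
    simp [hc]; ring
  have dc : ∀ t, HasDerivAt c (-12 * s t) t := fun t => by
    have := (((hasDerivAt_id t).sub_const (π / 4)).const_mul 12).cos
    refine this.congr_deriv ?_
    simp [hs]; ring
  have hW : MonotoneOn (fun t => q t * s t - 12 * c t * p t) (Icc (π / 4) (π / 3)) := by
    refine monotoneOn_Icc_of_hasDerivAt (f' := fun t => s t *
      (k * (duffing lam (p t) + cos t) + 144 * p t)) (fun t _ => ?_) fun t ht => ?_
    · refine (((h.sol.1.2 t).fun_mul (ds t)).fun_sub
        (((dc t).const_mul 12).fun_mul (h.sol.1.1 t))).congr_deriv ?_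
      ring
    · have hs0 : 0 ≤ s t := sin_nonneg_of_nonneg_of_le_pi (by linarith [ht.1]) (by linarith [ht.2])
      have hp0 := h.neg t ⟨by linarith [ht.1], by linarith [ht.2]⟩
      have hp1 := hmono ⟨by linarith, by linarith⟩ ⟨by linarith [ht.1], by linarith [ht.2]⟩ ht.1.le
      have hp2 : p t ^ 2 < lam / 2 + 1 / 16 := by nlinarith
      have hcos : 1 / 2 ≤ cos t := by
        rw [← cos_pi_div_three]
        exact cos_le_cos_of_nonneg_of_le_pi (by linarith [ht.1]) (by linarith) ht.2.le
      have key : -p t / 16 ≤ duffing lam (p t) + cos t := by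
        unfold duffing
        have e1 : 0 ≤ -p t * (lam / 2 + 1 / 16 - p t ^ 2) :=
          mul_nonneg (by linarith) (by linarith)
        have e2 : -p t / 8 ≤ 1 / 2 + -p t * (lam / 2) := by
          rcases le_total (-p t) 4 with h4 | h4
          · nlinarith [mul_nonneg (by linarith : 0 ≤ -p t) hlam]
          · have : 1 / 8 ≤ lam / 2 := by nlinarith
            nlinarith
        nlinarith
      have : 2304 * (-p t / 16) ≤ k * (duffing lam (p t) + cos t) :=
        mul_le_mul hk key (by linarith) (by linarith)
      exact mul_nonneg hs0 (by linarith)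
  have := hW ⟨le_rfl, by linarith⟩ ⟨by linarith, le_rfl⟩ (by linarith)
  have e1 : 12 * (π / 3 - π / 4) = π := by ring
  simp only [hs, hc, sub_self, mul_zero, sin_zero, cos_zero, e1, sin_pi, cos_pi] at this
  linarith [h.neg (π / 4) ⟨by linarith, by linarith⟩, h.neg (π / 3) ⟨by linarith, by linarith⟩]

theorem init_sq_le (hk : 0 < k) (hlam : 0 ≤ lam) (h : OddSol k lam p q) :
    p 0 ^ 2 ≤ lam + 1 := by
  have h0 := h.deriv_zero_nonneg hk hlam
  have h1 := h.neg 0 ⟨le_rfl, by linarith [pi_pos]⟩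
  unfold duffing at h0
  by_contra hlt
  push Not at hlt
  have : 1 < -p 0 := by nlinarith
  nlinarith

/-- The left side is p''(0), the slope of q at 0. Since q'' = k((3p² - λ)q - sin t) with 3p² - λ ≥ Q
on [0, π/4], an explicit barrier for q bounds this slope independently of k and λ. -/
theorem deriv_zero_le (hk : 2304 ≤ k) (hlam : 0 ≤ lam) (h : OddSol k lam p q) :
    k * (duffing lam (p 0) + 1) ≤ 7 := by
  have hpi := pi_gt_d2
  have hpi' := pi_lt_d2
  have hk0 : 0 < k := by linarith
  have hmono := h.monotoneOn_half hk0 hlam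
  have ha := h.neg 0 ⟨le_rfl, by linarith⟩
  set Q := lam / 2 + 3 / 16 with hQ
  have hQ0 : 0 < Q := by linarith
  have haQ : -p 0 ≤ 16 / 3 * Q := by nlinarith [h.init_sq_le hk0 hlam]
  obtain ⟨t₁, ht₁, e₁⟩ := exists_hasDerivAt_eq_slope p q (by linarith : π / 8 < π / 4)
    h.sol.1.continuous.continuousOn fun t _ => h.sol.1.1 t
  have hq₁ : q t₁ ≤ 3 * -p 0 := by
    rw [e₁, div_le_iff₀ (by linarith)]
    have h1 := hmono ⟨le_rfl, by linarith⟩ ⟨by linarith, by linarith⟩ (by linarith : 0 ≤ π / 8)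
    have h2 := h.neg (π / 4) ⟨by linarith, by linarith⟩
    nlinarith
  have hqnn : ∀ t ∈ Icc 0 t₁, 0 ≤ q t := fun t ht => by
    rcases eq_or_lt_of_le ht.1 with e | hlt
    · rw [← e, h.sol.2.1]
    · exact (h.deriv_pos_half hk0 hlam t ⟨hlt, by linarith [ht.2, ht₁.2]⟩).le
  -- In the barrier t/Q + m(t + kQt³/6) the first term absorbs the forcing. The cubic equals 54(-p
  -- 0)t₁³ ≥ 3(-p 0) ≥ q t₁ at t₁, as t₁³ ≥ 1/18. Finally 1/Q + m ≤ 16/3 + 3/4 < 7.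
  set m := 324 * -p 0 / (k * Q) with hm
  have hm0 : 0 ≤ m := div_nonneg (by linarith) (by positivity)
  have hmk : m * (k * Q) = 324 * -p 0 := div_mul_cancel₀ _ (by positivity)
  set d : ℝ → ℝ := fun t => t / Q + m * (t + k * Q * t ^ 3 / 6) - q t with hd
  set d' : ℝ → ℝ := fun t => 1 / Q + m * (1 + k * Q * t ^ 2 / 2) -
    k * (duffing lam (p t) + cos t) with hd'
  set d'' : ℝ → ℝ := fun t => m * (k * Q * t) - k * ((3 * p t ^ 2 - lam) * q t - sin t) with hd''
  have D1 : ∀ t, HasDerivAt d (d' t) t := fun t => by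
    refine ((((hasDerivAt_id t).div_const Q).fun_add (((hasDerivAt_id t).fun_add
      ((((hasDerivAt_id t).fun_pow 3).const_mul (k * Q)).div_const 6)).const_mul m)).fun_sub
      (h.sol.1.2 t)).congr_deriv ?_
    simp only [hd', id]
    push_cast
    ring
  have D2 : ∀ t, HasDerivAt d' (d'' t) t := fun t => by
    refine (((((((hasDerivAt_id t).fun_pow 2).const_mul (k * Q)).div_const 2).const_add
      1).const_mul m).const_add (1 / Q) |>.fun_sub (h.sol.hasDerivAt_deriv2 t)).congr_deriv ?_
    simp only [hd'', id]
    push_cast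
    ring
  have ht0 : 0 < t₁ := by linarith [ht₁.1]
  have hd0 : d 0 = 0 := by simp [hd, h.sol.2.1]
  have hd1 : 0 ≤ d t₁ := by
    have h3 : 1 / 18 ≤ t₁ ^ 3 := by
      have : (0.39 : ℝ) ≤ t₁ := by linarith [ht₁.1]
      have := pow_le_pow_left₀ (by norm_num) this 3
      norm_num at this
      linarith
    have h4 : m * (t₁ + k * Q * t₁ ^ 3 / 6) = m * t₁ + 54 * -p 0 * t₁ ^ 3 := by
      linear_combination (t₁ ^ 3 / 6) * hmk
    simp only [hd]
    rw [h4]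
    have h5 : 0 ≤ t₁ / Q := by positivity
    have h6 : 0 ≤ m * t₁ := by positivity
    nlinarith
  have hdle : ∀ t ∈ Icc 0 t₁, d'' t ≤ k * Q * d t := fun t ht => by
    have h1 := h.sq_lower_bound hk hlam t ⟨ht.1, by linarith [ht.2, ht₁.2]⟩
    have h2 := hqnn t ht
    have h3 := sin_le ht.1
    have h4 : Q * q t - t ≤ (3 * p t ^ 2 - lam) * q t - sin t := by
      have : Q * q t ≤ (3 * p t ^ 2 - lam) * q t := mul_le_mul_of_nonneg_right (by linarith) h2
      linarith
    have h5 := mul_le_mul_of_nonneg_left h4 hk0.le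
    have h6 : 0 ≤ k * Q * (m * (k * Q * t ^ 3 / 6)) := by
      have := ht.1
      positivity
    have h7 : k * Q * (t / Q) = k * t := by field_simp
    simp only [hd, hd'']
    nlinarith
  have hdnn : ∀ t ∈ Icc 0 t₁, 0 ≤ d t := by
    obtain ⟨s, hs, hmin⟩ := isCompact_Icc.exists_isMinOn (nonempty_Icc.2 ht0.le)
      (fun t _ => (D1 t).continuousAt.continuousWithinAt : ContinuousOn d (Icc 0 t₁))
    suffices 0 ≤ d s from fun t ht => this.trans (hmin ht)
    by_contra hneg
    push Not at hneg
    have hs1 : s ∈ Ioo 0 t₁ := by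
      refine ⟨lt_of_le_of_ne hs.1 fun e => ?_, lt_of_le_of_ne hs.2 fun e => ?_⟩
      · rw [← e, hd0] at hneg; linarith
      · rw [e] at hneg; linarith
    have hcrit := deriv_eq_zero_of_nonneg_interior (z := fun t => d t - d s) hs1
      ((D1 s).sub_const _) (sub_self _) fun t ht => sub_nonneg.2 (hmin ht)
    have hneg' : 0 < -d'' s := by
      have := hdle s hs
      have := mul_neg_of_pos_of_neg (mul_pos hk0 hQ0) hneg
      linarith
    obtain ⟨δ, hδ, H⟩ := exists_lt_right_of_deriv2_pos (u := fun t => -d t) (v := fun t => -d' t)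
      (fun t => (D1 t).fun_neg) (D2 s).fun_neg (by simp [hcrit]) hneg'
    have hmm : 0 < min δ (t₁ - s) := lt_min hδ (by linarith [hs1.2])
    have h1 := H (s + min δ (t₁ - s)) ⟨by linarith, by linarith [min_le_left δ (t₁ - s)]⟩
    have h2 : d s ≤ d (s + min δ (t₁ - s)) :=
      hmin ⟨by linarith [hs.1], by linarith [min_le_right δ (t₁ - s)]⟩
    linarith
  have hfin := deriv_nonneg_of_nonneg_right ht0 (D1 0) hd0 hdnn
  simp only [hd', cos_zero] at hfin
  have h1 : 1 / Q ≤ 16 / 3 := by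
    rw [div_le_iff₀ hQ0]
    linarith
  have h2 : m ≤ 3 / 4 := by
    rw [hm, div_le_iff₀ (by positivity)]
    nlinarith
  nlinarith

/-- The Wronskian of q and z starts at p''(0) ≤ 7 and, because z ≥ 1/4 on [0, π/4], loses at least
(k/4)(1 - √2/2) there. At π/2 it equals -z1 · q, which is therefore negative. -/
theorem linearized_deriv_mid_pos (hk : 2304 ≤ k) (hlam : 0 ≤ lam) (h : OddSol k lam p q)
    (hz : Linearized k lam p z z1) : 0 < z1 (π / 2) := by
  have hpi := pi_pos
  have hk0 : 0 < k := by linarith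
  have ha := h.neg 0 ⟨le_rfl, by linarith⟩
  have hquarter : ∀ t ∈ Icc 0 (π / 4), 1 / 4 ≤ z t := fun t ht => by
    have h1 := h.sq_lower_bound hk hlam t ht
    have h2 := h.init_sq_le hk0 hlam
    have h3 := h.neg t ⟨ht.1, by linarith [ht.2]⟩
    have h4 := h.le_linearized hk0 hz t ⟨ht.1, by linarith [ht.2]⟩
    have h5 : -p 0 * (1 / 4) ≤ -p t := by
      by_contra hlt
      push Not at hlt
      nlinarith
    exact le_of_mul_le_mul_left (h5.trans h4) (by linarith)
  have hA : AntitoneOn (fun t => k * (duffing lam (p t) + cos t) * z t - z1 t * q t -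
      k / 4 * cos t) (Icc 0 (π / 4)) := by
    refine antitoneOn_Icc_of_hasDerivAt (fun t ht => (h.sol.hasDerivAt_wronskian hz
      ⟨ht.1, by linarith [ht.2]⟩).fun_sub ((hasDerivAt_cos t).const_mul (k / 4))) fun t ht => ?_
    have h1 := hquarter t (Ioo_subset_Icc_self ht)
    have h2 := sin_nonneg_of_nonneg_of_le_pi ht.1.le (by linarith [ht.2])
    have := mul_nonneg (mul_nonneg hk0.le h2) (sub_nonneg.2 h1)
    nlinarith
  have h1 := hA ⟨le_rfl, by linarith⟩ ⟨by linarith, le_rfl⟩ (by linarith)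
  have h2 := (h.sol.wronskian_strictAnti hk0 hz (b := π / 2) (by linarith)
    (h.linearized_pos_half hk0 hz)).antitoneOn (a := π / 4) (b := π / 2) ⟨by linarith, by linarith⟩
    ⟨by linarith, le_rfl⟩ (by linarith)
  simp only [h.sol.2.1, hz.init, cos_zero, mul_zero, sub_zero, mul_one, cos_pi_div_four, h.mid,
    cos_pi_div_two] at h1 h2
  have h3 : duffing lam 0 = 0 := by simp [duffing]
  have h4 := h.deriv_zero_le hk hlam
  have h5 : √2 < 3 / 2 := by
    rw [sqrt_lt' (by norm_num)]
    norm_num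
  rw [h3] at h2
  have h6 : 0 < z1 (π / 2) * q (π / 2) := by nlinarith
  exact pos_of_mul_pos_left h6 h.deriv_mid_nonneg

/-- The odd solution is strictly stable once `k` is large, uniformly in `lam ≥ 0`. -/
theorem strictly_stable (hk : 2304 ≤ k) (hlam : 0 ≤ lam) (h : OddSol k lam p q)
    (hz : Linearized k lam p z z1) : (∀ t ∈ Icc 0 π, 0 < z t) ∧ 0 < z1 π := by
  have hpi := pi_pos
  have hk0 : 0 < k := by linarith
  have hmid := h.linearized_deriv_mid_pos hk hlam hz
  have hhalf := h.linearized_pos_half hk0 hz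
  have hm2 : π / 2 ∈ Icc 0 (π / 2) := ⟨by linarith, le_rfl⟩
  have e2 : π - π / 2 = π / 2 := by ring
  have hmem : ∀ t ∈ Icc (π / 2) π, t ∈ Icc 0 π := fun t ht => ⟨by linarith [ht.1], ht.2⟩
  have hmem' : ∀ t ∈ Icc (π / 2) π, π - t ∈ Icc 0 (π / 2) :=
    fun t ht => ⟨by linarith [ht.2], by linarith [ht.1]⟩
  have hmem'' : ∀ t ∈ Icc (π / 2) π, π - t ∈ Icc 0 π :=
    fun t ht => ⟨by linarith [ht.2], by linarith [ht.1]⟩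
  -- As p² is symmetric about π/2, z(π - t) solves the same linear equation. The Wronskian of the
  -- two is constant, equal to 2 z z1 at π/2 and to z1 π at π.
  have hW : MonotoneOn (fun t => z1 t * z (π - t) + z t * z1 (π - t)) (Icc (π / 2) π) := by
    refine monotoneOn_Icc_of_hasDerivAt (fun t ht => ((hz.d2 t (hmem t ht)).fun_mul
      ((hz.d1 _ (hmem'' t ht)).comp_const_sub _ _)).fun_add ((hz.d1 t (hmem t ht)).fun_mul
      ((hz.d2 _ (hmem'' t ht)).comp_const_sub _ _))) fun t ht => ?_
    rw [h.odd t]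
    apply le_of_eq
    ring
  have hWpos : ∀ t ∈ Icc (π / 2) π, 0 < z1 t * z (π - t) + z t * z1 (π - t) := fun t ht => by
    have := hW ⟨le_rfl, by linarith⟩ ht ht.1
    simp only [e2] at this
    nlinarith [mul_pos hmid (hhalf _ hm2)]
  have hratio : MonotoneOn (fun t => z t / z (π - t)) (Icc (π / 2) π) := by
    refine monotoneOn_Icc_of_hasDerivAt (fun t ht => (hz.d1 t (hmem t ht)).fun_div
      ((hz.d1 _ (hmem'' t ht)).comp_const_sub _ _) (hhalf _ (hmem' t ht)).ne') fun t ht => ?_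
    have := hWpos t (Ioo_subset_Icc_self ht)
    exact div_nonneg (by linarith) (sq_nonneg _)
  constructor
  · intro t ht
    rcases le_total t (π / 2) with hle | hle
    · exact hhalf t ⟨ht.1, hle⟩
    · have := hratio ⟨le_rfl, by linarith⟩ ⟨hle, ht.2⟩ hle
      simp only [e2] at this
      rw [div_self (hhalf _ hm2).ne', le_div_iff₀ (hhalf _ (hmem' t ⟨hle, ht.2⟩)), one_mul] at this
      exact (hhalf _ (hmem' t ⟨hle, ht.2⟩)).trans_le this
  · have := hWpos π ⟨by linarith, le_rfl⟩
    simpa [hz.init, hz.init_deriv] using this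

end OddSol

/-! ### Curvature at π: the stability bound and the energy bound -/

namespace NeumannSol

variable {k lam : ℝ} {u v z z1 : ℝ → ℝ}

/-- Let s be a maximum point of z on the window. As |u| < 4, z'' ≤ 48 k z(s); integrating twice back
from z1 π ≥ 0 gives z π ≥ z(s)(1 - 24/100). -/
theorem linearized_le_near_pi (hk : 0 < k) (hlam : 0 ≤ lam) (hlam2 : lam ≤ 2)
    (h : NeumannSol k lam u v) (hz : Linearized k lam u z z1) (hpos : ∀ t ∈ Icc 0 π, 0 < z t)
    (hπ : 0 ≤ z1 π) {η : ℝ} (hη : 0 < η) (hηπ : η ≤ π) (hkη : k * η ^ 2 ≤ 1 / 100) :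
    ∀ t ∈ Icc (π - η) π, z t ≤ 2 * z π := by
  have hmem : ∀ t ∈ Icc (π - η) π, t ∈ Icc 0 π := fun t ht => ⟨by linarith [ht.1], ht.2⟩
  obtain ⟨s, hs, hmax⟩ := isCompact_Icc.exists_isMaxOn (s := Icc (π - η) π)
    (nonempty_Icc.2 (by linarith))
    (fun t ht => (hz.d1 t (hmem t ht)).continuousAt.continuousWithinAt : ContinuousOn z _)
  suffices hs2 : z s ≤ 2 * z π from fun t ht => (hmax ht).trans hs2
  have hzs := hpos s (hmem s hs)
  have hsub : ∀ t ∈ Icc s π, t ∈ Icc (π - η) π := fun t ht => ⟨hs.1.trans ht.1, ht.2⟩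
  have hbound : ∀ t ∈ Icc s π, k * (3 * u t ^ 2 - lam) * z t ≤ 48 * k * z s := fun t ht => by
    have h1 := _root_.abs_lt.1 (h.abs_lt hk hlam t)
    have h2 : 3 * u t ^ 2 - lam ≤ 48 := by nlinarith
    have h3 : z t ≤ z s := hmax (hsub t ht)
    have h4 := hpos t (hmem t (hsub t ht))
    calc k * (3 * u t ^ 2 - lam) * z t ≤ k * 48 * z t :=
          mul_le_mul_of_nonneg_right (mul_le_mul_of_nonneg_left h2 hk.le) h4.le
      _ ≤ k * 48 * z s := mul_le_mul_of_nonneg_left h3 (by positivity)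
      _ = _ := by ring
  have hA : AntitoneOn (fun t => z1 t - 48 * k * z s * t) (Icc s π) :=
    antitoneOn_Icc_of_hasDerivAt (fun t ht => (hz.d2 t (hmem t (hsub t ht))).fun_sub
      ((hasDerivAt_id t).const_mul (48 * k * z s))) fun t ht => by
        linarith [hbound t (Ioo_subset_Icc_self ht)]
  have hB : MonotoneOn (fun t => z t - 24 * k * z s * (π - t) ^ 2) (Icc s π) := by
    refine monotoneOn_Icc_of_hasDerivAt (fun t ht => (hz.d1 t (hmem t (hsub t ht))).fun_sub
      ((((hasDerivAt_id t).const_sub π).fun_pow 2).const_mul (24 * k * z s))) fun t ht => ?_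
    have := hA (Ioo_subset_Icc_self ht) ⟨hs.2, le_rfl⟩ ht.2.le
    simp only [id] at this ⊢
    push_cast
    nlinarith
  have := hB ⟨le_rfl, hs.2⟩ ⟨hs.2, le_rfl⟩ hs.2
  simp only [sub_self] at this
  have h5 : k * (π - s) ^ 2 ≤ 1 / 100 := by
    have : (π - s) ^ 2 ≤ η ^ 2 := pow_le_pow_left₀ (by linarith [hs.2]) (by linarith [hs.1]) 2
    nlinarith
  nlinarith [mul_le_mul_of_nonneg_left h5 hzs.le]

/-- A stable increasing solution has almost vanishing second derivative at `π`. -/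
theorem curvature_bound (hk : 0 < k) (hlam : 0 ≤ lam) (hlam2 : lam ≤ 2)
    (h : NeumannSol k lam u v) (hz : Linearized k lam u z z1) (hpos : ∀ t ∈ Icc 0 π, 0 < z t)
    (hπ : 0 ≤ z1 π) (hv : ∀ t ∈ Ioo 0 π, 0 < v t) {η : ℝ} (hη : 0 < η) (hηπ : η < π)
    (hkη : k * η ^ 2 ≤ 1 / 100) {κ : ℝ} (hκ : κ = 1 - duffing lam (u π)) (hκη : 4 * η ≤ κ) :
    κ ^ 2 * (k * η) ≤ 128 := by
  have hpi := pi_pos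
  have hπm : π ∈ Icc 0 π := ⟨hpi.le, le_rfl⟩
  have hzπ := hpos π hπm
  have hκ0 : 0 < κ := by linarith
  have hmem : ∀ t ∈ Icc (π - η) π, t ∈ Icc 0 π := fun t ht => ⟨by linarith [ht.1], ht.2⟩
  have hz2 := h.linearized_le_near_pi hk hlam hlam2 hz hpos hπ hη hηπ.le hkη
  set W : ℝ → ℝ := fun t => k * (duffing lam (u t) + cos t) * z t - z1 t * v t with hW
  have dW : ∀ t ∈ Icc 0 π, HasDerivAt W (-(k * sin t * z t)) t :=
    fun t ht => h.hasDerivAt_wronskian hz ht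
  have hWanti : AntitoneOn W (Icc 0 π) :=
    (h.wronskian_strictAnti hk hz le_rfl hpos).antitoneOn
  have hWπ : W π = -(k * κ * z π) := by
    simp only [hW, h.2.2, cos_pi, hκ]
    ring
  -- W moves at speed at most 2k z(π) on the window, whose length is at most κ/4, so it keeps half
  -- of its end value -kκ z(π).
  have hWnear : ∀ t ∈ Icc (π - η) π, W t ≤ -(k * κ * z π) / 2 := fun t ht => by
    have hm : MonotoneOn (fun t => W t + 2 * k * z π * t) (Icc (π - η) π) := by
      refine monotoneOn_Icc_of_hasDerivAt (fun t ht => (dW t (hmem t ht)).fun_add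
        ((hasDerivAt_id t).const_mul (2 * k * z π))) fun t ht => ?_
      have h1 := hz2 t (Ioo_subset_Icc_self ht)
      have h2 := hpos t (hmem t (Ioo_subset_Icc_self ht))
      have h3 : sin t * z t ≤ 2 * z π :=
        (mul_le_of_le_one_left h2.le (sin_le_one t)).trans h1
      nlinarith
    have h1 := hm ht ⟨by linarith, le_rfl⟩ ht.2
    simp only [hWπ] at h1
    have h2 : π - t ≤ κ / 4 := by linarith [ht.1]
    have h3 := mul_le_mul_of_nonneg_left h2 (by positivity : 0 ≤ 2 * k * z π)
    nlinarith
  have dR : ∀ t ∈ Icc 0 π, HasDerivAt (fun t => v t / z t) (W t / z t ^ 2) t := fun t ht => by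
    refine ((h.1.2 t).fun_div (hz.d1 t ht) (hpos t ht).ne').congr_deriv ?_
    simp only [hW]
    ring
  -- This is the lower bound for v/z at π - η obtained by integrating (v/z)' = W/z² back from v π =
  -- 0.
  set m := k * η * κ / (8 * z π) with hm
  have hm0 : 0 < m := by positivity
  have hRη : m ≤ v (π - η) / z (π - η) := by
    have hA : AntitoneOn (fun t => v t / z t + k * κ / (8 * z π) * t) (Icc (π - η) π) := by
      refine antitoneOn_Icc_of_hasDerivAt (fun t ht => (dR t (hmem t ht)).fun_add
        ((hasDerivAt_id t).const_mul (k * κ / (8 * z π)))) fun t ht => ?_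
      have h1 := hWnear t (Ioo_subset_Icc_self ht)
      have h2 := hz2 t (Ioo_subset_Icc_self ht)
      have h3 := hpos t (hmem t (Ioo_subset_Icc_self ht))
      have h4 : z t ^ 2 ≤ 4 * z π ^ 2 := by nlinarith
      have h5 : W t / z t ^ 2 ≤ -(k * κ / (8 * z π)) := by
        rw [div_le_iff₀ (by positivity)]
        have h6 : k * κ / (8 * z π) * z t ^ 2 ≤ k * κ / (8 * z π) * (4 * z π ^ 2) :=
          mul_le_mul_of_nonneg_left h4 (by positivity)
        have h7 : k * κ / (8 * z π) * (4 * z π ^ 2) = k * κ * z π / 2 := by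
          field_simp
          ring
        linarith
      linarith
    have h1 := hA ⟨le_rfl, by linarith⟩ ⟨by linarith, le_rfl⟩ (by linarith)
    simp only [h.2.2, zero_div, zero_add] at h1
    have h2 : m = k * κ / (8 * z π) * η := by
      rw [hm]
      ring
    rw [h2]
    linarith
  have hηm : π - η ∈ Icc 0 π := ⟨by linarith, by linarith⟩
  have hW0 : 0 ≤ W 0 := by
    have h1 := deriv_nonneg_of_nonneg_right hpi (h.1.2 0) h.2.1 fun t ht => by
      rcases eq_or_lt_of_le ht.1 with e | hlt
      · rw [← e, h.2.1]
      · rcases eq_or_lt_of_le ht.2 with e | hlt'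
        · rw [e, h.2.2]
        · exact (hv t ⟨hlt, hlt'⟩).le
    simpa [hW, h.2.1, hz.init] using h1
  have hWη := hWnear (π - η) ⟨le_rfl, by linarith⟩
  have hkkz : 0 < k * κ * z π := by positivity
  -- From the zero c of W onwards v/z decreases, hence v ≥ m z up to π - η. The drop of W there is
  -- then paid for by the rise of u, which is less than 8.
  obtain ⟨c, hc, hc0⟩ := intermediate_value_Icc' hηm.1
    (fun t ht => (dW t ⟨ht.1, ht.2.trans hηm.2⟩).continuousAt.continuousWithinAt :
      ContinuousOn W (Icc 0 (π - η))) ⟨by linarith, hW0⟩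
  have hcm : ∀ t ∈ Icc c (π - η), t ∈ Icc 0 π :=
    fun t ht => ⟨hc.1.trans ht.1, ht.2.trans hηm.2⟩
  have hvz : ∀ t ∈ Icc c (π - η), m * z t ≤ v t := fun t ht => by
    have hA : AntitoneOn (fun t => v t / z t) (Icc c (π - η)) :=
      antitoneOn_Icc_of_hasDerivAt (fun t ht => dR t (hcm t ht)) fun t ht => by
        have h1 := hWanti (hcm c ⟨le_rfl, hc.2⟩) (hcm t (Ioo_subset_Icc_self ht)) ht.1.le
        rw [hc0] at h1
        exact div_nonpos_of_nonpos_of_nonneg h1 (sq_nonneg _)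
    have := hRη.trans (hA ht ⟨hc.2, le_rfl⟩ ht.2)
    rwa [le_div_iff₀ (hpos t (hcm t ht))] at this
  have hB : MonotoneOn (fun t => m * W t + k * u t) (Icc c (π - η)) := by
    refine monotoneOn_Icc_of_hasDerivAt (fun t ht => ((dW t (hcm t ht)).const_mul m).fun_add
      ((h.1.1 t).const_mul k)) fun t ht => ?_
    have h1 := hvz t (Ioo_subset_Icc_self ht)
    have h2 := hpos t (hcm t (Ioo_subset_Icc_self ht))
    have h3 : m * (sin t * z t) ≤ m * z t :=
      mul_le_mul_of_nonneg_left (mul_le_of_le_one_left h2.le (sin_le_one t)) hm0.le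
    have h4 := mul_le_mul_of_nonneg_left (h3.trans h1) hk.le
    linarith
  have h1 := hB ⟨le_rfl, hc.2⟩ ⟨hc.2, le_rfl⟩ hc.2
  simp only [hc0, mul_zero, zero_add] at h1
  have h2 := _root_.abs_lt.1 (h.abs_lt hk hlam c)
  have h3 := _root_.abs_lt.1 (h.abs_lt hk hlam (π - η))
  have h4 : -(8 * k) ≤ m * W (π - η) := by nlinarith
  have h5 := mul_le_mul_of_nonneg_left hWη hm0.le
  have h6 : m * (-(k * κ * z π) / 2) = -(k * (κ ^ 2 * (k * η)) / 16) := by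
    rw [hm]
    field_simp
    ring
  have h7 : k * (κ ^ 2 * (k * η)) ≤ k * 128 := by linarith
  exact le_of_mul_le_mul_left h7 hk

end NeumannSol

/-- The energy of a solution, up to the factor `ε²` in front of the kinetic term. -/
theorem NeumannSol.hasDerivAt_energy {k lam e : ℝ} {u v : ℝ → ℝ} (hke : k * e = 1)
    (h : NeumannSol k lam u v) (t : ℝ) :
    HasDerivAt (fun t => e * v t ^ 2 / 2 - u t ^ 4 / 4 + lam * u t ^ 2 / 2 - u t * cos t)
      (u t * sin t) t := by
  refine (((((((h.1.2 t).fun_pow 2).const_mul e).div_const 2).fun_sub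
    (((h.1.1 t).fun_pow 4).div_const 4)).fun_add ((((h.1.1 t).fun_pow 2).const_mul lam).div_const
    2)).fun_sub ((h.1.1 t).fun_mul (hasDerivAt_cos t))).congr_deriv ?_
  unfold duffing
  push_cast
  linear_combination (v t * (u t ^ 3 - lam * u t + cos t)) * hke

/-- A uniform gap between √(λ/3), above which the nonlinearity is increasing, and the lower bound
for |p| away from the layer. -/
theorem sqrt_gap {lam : ℝ} (hlam : 0 ≤ lam) (hlam2 : lam ≤ 2) :
    √(lam / 3) + 1 / 32 ≤ √(lam / 2 + 1 / 16) := by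
  have hr2 : √(lam / 2 + 1 / 16) ^ 2 = lam / 2 + 1 / 16 := sq_sqrt (by linarith)
  have hc2 : √(lam / 3) ^ 2 = lam / 3 := sq_sqrt (by linarith)
  have hr1 : √(lam / 2 + 1 / 16) ≤ 11 / 10 := sqrt_le_iff.2 ⟨by norm_num, by norm_num; linarith⟩
  have hc1 : √(lam / 3) ≤ 9 / 10 := sqrt_le_iff.2 ⟨by norm_num, by norm_num; linarith⟩
  nlinarith [sqrt_nonneg (lam / 2 + 1 / 16), sqrt_nonneg (lam / 3)]

set_option maxHeartbeats 400000 in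
/-- A solution below the odd solution which is positive at `π` is strongly curved there. -/
theorem OddSol.curvature_lower_bound {k lam : ℝ} {p q u v : ℝ → ℝ} (hk : 2304 ≤ k)
    (hlam : 0 ≤ lam) (hlam2 : lam ≤ 2) (hp : OddSol k lam p q) (h : NeumannSol k lam u v)
    (hlt : ∀ t, u t < p t) (hmono : MonotoneOn u (Icc 0 π)) (hb : 0 < u π) {κ : ℝ}
    (hκ : κ = 1 - duffing lam (u π)) : 1 / 2000 < κ := by
  by_contra hκle
  push Not at hκle
  have hpi := pi_gt_d2
  have hpi' := pi_lt_d2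
  have hk0 : 0 < k := by linarith
  have hpπ : p π = -p 0 := by simpa using hp.odd 0
  have hlt0 := hlt 0
  have hltπ := hlt π
  have hduff : duffing lam (u π) = u π ^ 3 - lam * u π := rfl
  have hb2 : lam < u π ^ 2 := by
    by_contra hle
    push Not at hle
    nlinarith [mul_nonneg hb.le (sub_nonneg.2 hle)]
  set Δ : ℝ → ℝ := fun t => (k⁻¹ * q t ^ 2 / 2 - p t ^ 4 / 4 + lam * p t ^ 2 / 2 - p t * cos t) -
    (k⁻¹ * v t ^ 2 / 2 - u t ^ 4 / 4 + lam * u t ^ 2 / 2 - u t * cos t) with hΔ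
  have hke : k * k⁻¹ = 1 := mul_inv_cancel₀ hk0.ne'
  have dΔ : ∀ t, HasDerivAt Δ ((p t - u t) * sin t) t := fun t =>
    ((hp.sol.hasDerivAt_energy hke t).fun_sub (h.hasDerivAt_energy hke t)).congr_deriv (by ring)
  have hΔmono : MonotoneOn Δ (Icc 0 π) := monotoneOn_Icc_of_hasDerivAt (fun t _ => dΔ t)
    fun t ht => mul_nonneg (by linarith [hlt t]) (sin_pos_of_pos_of_lt_pi ht.1 ht.2).le
  -- The kinetic terms vanish at the ends and p π = -p 0 cancels the terms in p, leaving F(-u 0) -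
  -- F(u π) with F' ≤ F'(u π) = κ beyond u π, as u(π)² > λ.
  have hΔle : Δ π - Δ 0 ≤ κ * ((p 0 - u 0) + (p π - u π)) := by
    have hG : AntitoneOn (fun x => -x ^ 4 / 4 + lam * x ^ 2 / 2 + x - κ * x)
        (Icc (u π) (-u 0)) := by
      refine antitoneOn_Icc_of_hasDerivAt (f' := fun x => -x ^ 3 + lam * x + 1 - κ)
        (fun x _ => ?_) fun x hx => ?_
      · refine ((((((hasDerivAt_id x).fun_pow 4).fun_neg.div_const 4).fun_add
          ((((hasDerivAt_id x).fun_pow 2).const_mul lam).div_const 2)).fun_add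
          (hasDerivAt_id x)).fun_sub ((hasDerivAt_id x).const_mul κ)).congr_deriv ?_
        simp only [id]
        push_cast
        ring
      · rw [hκ, hduff]
        have h1 : 0 < x - u π := by linarith [hx.1]
        have h2 : 0 ≤ x ^ 2 + x * u π + u π ^ 2 - lam := by nlinarith [hx.1]
        nlinarith [mul_nonneg h1.le h2]
    have := hG ⟨le_rfl, by linarith⟩ ⟨by linarith, le_rfl⟩ (by linarith)
    simp only at this
    simp only [hΔ, hp.sol.2.1, hp.sol.2.2, h.2.1, h.2.2, cos_zero, cos_pi, hpπ]
    linarith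
  set h0 := p 0 - u 0 with hh0
  set hπ := p π - u π with hhπ
  have hsum : h0 + hπ < 8 := by
    have h1 := _root_.abs_lt.1 (h.abs_lt hk0 hlam 0)
    rw [hh0, hhπ, hpπ]
    linarith
  have hlow := hp.sq_lower_bound hk hlam
  have hright : ∀ t ∈ Icc (3 * π / 4) π, lam / 2 + 1 / 16 ≤ p t ^ 2 ∧ 0 < p t := fun t ht => by
    have e := hp.odd (π - t)
    rw [sub_sub_cancel] at e
    have h1 := hlow (π - t) ⟨by linarith [ht.2], by linarith [ht.1]⟩
    have h2 := hp.neg (π - t) ⟨by linarith [ht.2], by linarith [ht.1]⟩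
    rw [e]
    exact ⟨by nlinarith, by linarith⟩
  have d1 : ∀ t, HasDerivAt (fun t => p t - u t) (q t - v t) t :=
    fun t => (hp.sol.1.1 t).fun_sub (h.1.1 t)
  have d2 : ∀ t, HasDerivAt (fun t => q t - v t)
      (k * ((p t ^ 2 + p t * u t + u t ^ 2 - lam) * (p t - u t))) t := fun t =>
    ((hp.sol.1.2 t).fun_sub (h.1.2 t)).congr_deriv (by rw [← duffing_sub]; ring)
  -- If u is still low at 5π/6, the gap p - u ≥ 1/32 on [3π/4, 5π/6] makes Δ grow by π/768 > 8/2000.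
  -- Otherwise p - u is convex near both ends with zero end slopes, so Δ grows by a fixed fraction
  -- of h0 + hπ.
  rcases lt_or_ge (u (5 * π / 6)) (√(lam / 3)) with hc | hc
  · have hM : MonotoneOn (fun t => Δ t - 1 / 64 * t) (Icc (3 * π / 4) (5 * π / 6)) := by
      refine monotoneOn_Icc_of_hasDerivAt (fun t _ => (dΔ t).fun_sub
        ((hasDerivAt_id t).const_mul (1 / 64))) fun t ht => ?_
      have h1 := hright t ⟨ht.1.le, by linarith [ht.2]⟩
      have h2 := hmono ⟨by linarith [ht.1], by linarith [ht.2]⟩ ⟨by linarith, by linarith⟩ ht.2.le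
      have h3 : 1 / 2 ≤ sin t := by
        rw [← sin_pi_sub t, ← sin_pi_div_six]
        exact sin_le_sin_of_le_of_le_pi_div_two (by linarith) (by linarith [ht.1])
          (by linarith [ht.2])
      have hrp : √(lam / 2 + 1 / 16) ≤ p t := sqrt_le_iff.2 ⟨h1.2.le, h1.1⟩
      have h4 : 1 / 32 ≤ p t - u t := by linarith [sqrt_gap hlam hlam2]
      have h5 := mul_le_mul h4 h3 (by norm_num) (by linarith)
      simp only [mul_one]
      linarith
    have h1 := hM ⟨le_rfl, by linarith⟩ ⟨by linarith, le_rfl⟩ (by linarith)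
    have h2 := hΔmono (a := 0) (b := 3 * π / 4) ⟨le_rfl, by linarith⟩ ⟨by linarith, by linarith⟩
      (by linarith)
    have h3 := hΔmono (a := 5 * π / 6) (b := π) ⟨by linarith, by linarith⟩ ⟨by linarith, le_rfl⟩
      (by linarith)
    simp only at h1
    have h4 := mul_le_mul hκle hsum.le (by linarith) (by norm_num)
    linarith
  · have hc3 : lam / 3 ≤ u (5 * π / 6) ^ 2 ∧ 0 ≤ u (5 * π / 6) := by
      have := sq_sqrt (by linarith : 0 ≤ lam / 3)
      have h1 := sqrt_nonneg (lam / 3)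
      exact ⟨by nlinarith, by linarith⟩
    have hq1 : MonotoneOn (fun t => q t - v t) (Icc (5 * π / 6) π) := by
      refine monotoneOn_Icc_of_hasDerivAt (fun t _ => d2 t) fun t ht => ?_
      have h1 := hmono (a := 5 * π / 6) (b := t) ⟨by linarith, by linarith⟩
        ⟨by linarith [ht.1], ht.2.le⟩ ht.1.le
      have h2 := hlt t
      exact mul_nonneg hk0.le (mul_nonneg (by nlinarith) (by linarith))
    have hA : AntitoneOn (fun t => p t - u t) (Icc (5 * π / 6) π) := by
      refine antitoneOn_Icc_of_hasDerivAt (fun t _ => d1 t) fun t ht => ?_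
      have := hq1 (Ioo_subset_Icc_self ht) ⟨by linarith, le_rfl⟩ ht.2.le
      simpa [hp.sol.2.2, h.2.2] using this
    have hMr : MonotoneOn (fun t => Δ t + hπ * cos t) (Icc (5 * π / 6) π) := by
      refine monotoneOn_Icc_of_hasDerivAt (fun t _ => (dΔ t).fun_add
        ((hasDerivAt_cos t).const_mul hπ)) fun t ht => ?_
      have h1 := hA (Ioo_subset_Icc_self ht) ⟨by linarith, le_rfl⟩ ht.2.le
      simp only at h1
      have h2 := sin_nonneg_of_nonneg_of_le_pi (x := t) (by linarith [ht.1]) ht.2.le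
      nlinarith
    have hq2 : MonotoneOn (fun t => q t - v t) (Icc 0 (π / 4)) := by
      refine monotoneOn_Icc_of_hasDerivAt (fun t _ => d2 t) fun t ht => ?_
      have h1 := hlow t (Ioo_subset_Icc_self ht)
      have h2 := hlt t
      have h3 := hp.neg t ⟨ht.1.le, by linarith [ht.2]⟩
      exact mul_nonneg hk0.le (mul_nonneg (by nlinarith) (by linarith))
    have hB : MonotoneOn (fun t => p t - u t) (Icc 0 (π / 4)) := by
      refine monotoneOn_Icc_of_hasDerivAt (fun t _ => d1 t) fun t ht => ?_
      have := hq2 ⟨le_rfl, by linarith⟩ (Ioo_subset_Icc_self ht) ht.1.le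
      simpa [hp.sol.2.1, h.2.1] using this
    have hMl : MonotoneOn (fun t => Δ t + h0 * cos t) (Icc 0 (π / 4)) := by
      refine monotoneOn_Icc_of_hasDerivAt (fun t _ => (dΔ t).fun_add
        ((hasDerivAt_cos t).const_mul h0)) fun t ht => ?_
      have h1 := hB ⟨le_rfl, by linarith⟩ (Ioo_subset_Icc_self ht) ht.1.le
      simp only at h1
      have h2 := sin_nonneg_of_nonneg_of_le_pi (x := t) ht.1.le (by linarith [ht.2])
      nlinarith
    have h1 := hMl ⟨le_rfl, by linarith⟩ ⟨by linarith, le_rfl⟩ (by linarith)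
    have h2 := hMr ⟨le_rfl, by linarith⟩ ⟨by linarith, le_rfl⟩ (by linarith)
    have h3 := hΔmono (a := π / 4) (b := 5 * π / 6) ⟨by linarith, by linarith⟩
      ⟨by linarith, by linarith⟩ (by linarith)
    have e5 : cos (5 * π / 6) = -(√3 / 2) := by
      rw [show 5 * π / 6 = π - π / 6 by ring, cos_pi_sub, cos_pi_div_six]
    simp only [cos_zero, cos_pi_div_four, cos_pi, e5] at h1 h2
    have hs2 : √2 < 18 / 10 := by
      rw [sqrt_lt' (by norm_num)]
      norm_num
    have hs3 : √3 < 18 / 10 := by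
      rw [sqrt_lt' (by norm_num)]
      norm_num
    have p0 : 0 < h0 := by linarith
    have pπ : 0 < hπ := by linarith
    have h4 := mul_le_mul_of_nonneg_right hκle (by linarith : 0 ≤ h0 + hπ)
    have h5 := mul_le_mul_of_nonneg_left hs2.le p0.le
    have h6 := mul_le_mul_of_nonneg_left hs3.le pπ.le
    linarith

/-! ### Nonpositive supersolutions and comparison with the odd solution -/

/-- A nonpositive Neumann supersolution on `[0, π]`, strict in the interior. -/
structure NegSupersol (k lam : ℝ) (σ σ1 σ2 : ℝ → ℝ) : Prop where
  d1 : ∀ t ∈ Icc 0 π, HasDerivAt σ (σ1 t) t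
  d2 : ∀ t ∈ Icc 0 π, HasDerivAt σ1 (σ2 t) t
  super : ∀ t ∈ Icc 0 π, σ2 t ≤ k * (duffing lam (σ t) + cos t)
  strict : ∀ t ∈ Ioo 0 π, σ2 t < k * (duffing lam (σ t) + cos t)
  bound : ∀ t ∈ Icc 0 π, |σ t| ≤ lam + 2
  nonpos : ∀ t ∈ Icc 0 π, σ t ≤ 0
  left : σ1 0 = 0
  right : σ1 π = 0

/-- At -√(λ/3), the local maximum of the cubic, the value is 2(λ/3)^(3/2), which exceeds the forcing
amplitude 1 once λ ≥ 2. -/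
theorem exists_negSupersol_const {k lam : ℝ} (hk : 0 < k) (hlam : 2 ≤ lam) :
    ∃ σ σ1 σ2, NegSupersol k lam σ σ1 σ2 := by
  set s := √(lam / 3) with hs
  have hs2 : s ^ 2 = lam / 3 := sq_sqrt (by linarith)
  have hs0 : 0 ≤ s := sqrt_nonneg _
  have hs1 : 0.8 ≤ s := le_sqrt_of_sq_le (by norm_num; linarith)
  have key : ∀ t, 0 < k * (duffing lam (-s) + cos t) := fun t => by
    have h1 := neg_one_le_cos t
    have h2 : duffing lam (-s) = 2 * s ^ 3 := by
      unfold duffing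
      rw [show lam = 3 * s ^ 2 by linarith]
      ring
    have h3 := pow_le_pow_left₀ (by norm_num) hs1 3
    norm_num at h3
    rw [h2]
    exact mul_pos hk (by linarith)
  refine ⟨fun _ => -s, fun _ => 0, fun _ => 0, fun t _ => hasDerivAt_const _ _,
    fun t _ => hasDerivAt_const _ _, fun t _ => (key t).le, fun t _ => key t, fun t _ => ?_,
    fun t _ => by linarith, rfl, rfl⟩
  rw [abs_neg, abs_of_nonneg hs0]
  nlinarith

/-- Where u < 0, raising λ raises -λu; so a negative solution for λ' becomes a strict supersolution
for λ. -/
theorem NeumannSol.negSupersol {k lam lam' : ℝ} {u v : ℝ → ℝ} (hk : 0 < k) (hlam : 0 ≤ lam')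
    (hlt : lam' < lam) (h : NeumannSol k lam' u v) (hv : ∀ t ∈ Ioo 0 π, 0 < v t)
    (hπ : u π ≤ 0) : NegSupersol k lam u v (fun t => k * (duffing lam' (u t) + cos t)) := by
  have hmono : StrictMonoOn u (Icc 0 π) := strictMonoOn_Icc_of_hasDerivAt (fun t _ => h.1.1 t) hv
  have hneg : ∀ t ∈ Ico 0 π, u t < 0 := fun t ht =>
    (hmono (Ico_subset_Icc_self ht) ⟨pi_pos.le, le_rfl⟩ ht.2).trans_le hπ
  have hnp : ∀ t ∈ Icc 0 π, u t ≤ 0 := fun t ht => by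
    rcases eq_or_lt_of_le ht.2 with e | hlt
    · rwa [e]
    · exact (hneg t ⟨ht.1, hlt⟩).le
  refine ⟨fun t _ => h.1.1 t, fun t _ => h.1.2 t, fun t ht => ?_, fun t ht => ?_,
    fun t _ => by linarith [h.abs_lt hk hlam t], hnp, h.2.1, h.2.2⟩
  · refine mul_le_mul_of_nonneg_left ?_ hk.le
    unfold duffing
    nlinarith [hnp t ht]
  · refine mul_lt_mul_of_pos_left ?_ hk
    unfold duffing
    nlinarith [hneg t (Ioo_subset_Ico_self ht)]

/-- Minimality applied to u and to its partner -u(· + π) bounds u 0 by p 0 from both sides. -/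
theorem OddSol.eq_of_forall_le {k lam : ℝ} {p q : ℝ → ℝ} (hp : OddSol k lam p q)
    (hmin : ∀ u v, NeumannSol k lam u v → ∀ t ∈ Icc 0 π, p t ≤ u t) {u v : ℝ → ℝ}
    (hu : NeumannSol k lam u v) : u = p := by
  have h1 := hmin u v hu 0 ⟨le_rfl, pi_pos.le⟩
  have h2 := hmin _ _ hu.neg_shift π ⟨pi_pos.le, le_rfl⟩
  simp only [hu.shift_eq, sub_self] at h2
  have h3 := hp.odd 0
  rw [sub_zero] at h3
  exact hu.unique hp.sol (t₀ := 0) (by linarith) (by rw [hu.2.1, hp.sol.2.1])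

theorem OddSol.pos_right {k lam : ℝ} {p q : ℝ → ℝ} (hp : OddSol k lam p q) : 0 < p π := by
  have h1 := hp.odd 0
  rw [sub_zero] at h1
  linarith [hp.neg 0 ⟨le_rfl, by linarith [pi_pos]⟩]

theorem OddSol.isUp {ε lam : ℝ} {p q : ℝ → ℝ} (hε : 0 < ε) (hlam : 0 ≤ lam)
    (hp : OddSol (ε ^ 2)⁻¹ lam p q) : IsUp ε lam p := by
  have e := hp.sol.1.deriv_eq
  refine ⟨((isNeumannSolution_iff hε).2 ⟨q, hp.sol⟩).1, hp.sol.periodic, by rw [e, hp.sol.2.1],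
    hp.mid, ?_⟩
  rw [e]
  exact hp.deriv_pos_half (by positivity) hlam

/-- For λ = 0 the cubic is monotone, so (u - p)(u' - p') is nondecreasing; it vanishes at both ends,
but would become positive right after 0 if u 0 ≠ p 0. -/
theorem OddSol.eq_of_lam_eq_zero {k : ℝ} {p q u v : ℝ → ℝ} (hk : 0 < k) (hp : OddSol k 0 p q)
    (hu : NeumannSol k 0 u v) : u = p := by
  have hpi := pi_pos
  suffices h0 : u 0 = p 0 from hu.unique hp.sol (t₀ := 0) h0 (by rw [hu.2.1, hp.sol.2.1])
  by_contra hne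
  set f : ℝ → ℝ := fun t => (u t - p t) * (v t - q t) with hf
  set f' : ℝ → ℝ := fun t => (v t - q t) ^ 2 +
    k * (u t ^ 2 + u t * p t + p t ^ 2) * (u t - p t) ^ 2 with hf'
  have df : ∀ t, HasDerivAt f (f' t) t := fun t => by
    refine (((hu.1.1 t).fun_sub (hp.sol.1.1 t)).fun_mul
      ((hu.1.2 t).fun_sub (hp.sol.1.2 t))).congr_deriv ?_
    simp only [hf', duffing]
    ring
  have hq : ∀ t, 0 ≤ u t ^ 2 + u t * p t + p t ^ 2 := fun t => by
    nlinarith [sq_nonneg (u t + p t), sq_nonneg (u t), sq_nonneg (p t)]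
  have hmono : MonotoneOn f (Icc 0 π) := monotoneOn_Icc_of_hasDerivAt (fun t _ => df t)
    fun t _ => by
      have := hq t
      positivity
  have h0 : f 0 = 0 := by simp [hf, hu.2.1, hp.sol.2.1]
  have hπ : f π = 0 := by simp [hf, hu.2.2, hp.sol.2.2]
  have hp0 := hp.neg 0 ⟨le_rfl, by linarith⟩
  have hpos : 0 < f' 0 := by
    have h1 : 0 < u 0 ^ 2 + u 0 * p 0 + p 0 ^ 2 := by
      nlinarith [sq_nonneg (2 * u 0 + p 0), mul_pos_of_neg_of_neg hp0 hp0]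
    have h2 : 0 < (u 0 - p 0) ^ 2 := by
      have := sub_ne_zero.2 hne
      positivity
    simp only [hf']
    positivity
  obtain ⟨δ, hδ, H⟩ := exists_pos_right_of_hasDerivAt (df 0) h0 hpos
  have hm : 0 < min δ π := lt_min hδ hpi
  have h1 := H (min δ π) ⟨hm, by simp⟩
  have h2 := hmono ⟨hm.le, min_le_right _ _⟩ ⟨hpi.le, le_rfl⟩ (min_le_right δ π)
  linarith

/-! ### The minimal solution and the intermediate solution -/

namespace ShootingFamily

variable {k lam : ℝ} {U V : ℝ → ℝ → ℝ}

/-- Sliding towards U α, used as its own supersolution, keeps the members from below underneath it;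
the first-order expansion turns this into signs of z and z1 π. -/
theorem minimal_linearized_pos (h : ShootingFamily k lam U V) {α : ℝ} (hα : V α π = 0)
    (hlow : -(lam + 3) < α) (hneg : ∀ γ ∈ Ico (-(lam + 3)) α, V γ π < 0) {z z1 : ℝ → ℝ}
    (hz : Linearized k lam (U α) z z1) : (∀ t ∈ Icc 0 π, 0 < z t) ∧ 0 ≤ z1 π := by
  have hN := h.neumannSol hα
  have hs := h.slide hneg (fun t _ => hN.1.1 t) (fun t _ => hN.1.2 t) (fun _ _ => le_rfl)
    (fun t _ => (hN.abs_lt h.hk h.hlam t).le) hN.2.1 hN.2.2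
  have := h.linearized_nonneg hα hz hlow fun γ hγ =>
    ⟨fun t ht => (hs γ hγ t ht).le, (hneg γ hγ).le⟩
  exact ⟨hN.linearized_pos h.hk h.hlam hz this.1 this.2, this.2⟩

theorem minimal_deriv_pos (h : ShootingFamily k lam U V) {α : ℝ} (hα : V α π = 0)
    (hlow : -(lam + 3) < α) (hneg : ∀ γ ∈ Ico (-(lam + 3)) α, V γ π < 0) :
    ∀ t ∈ Ioo 0 π, 0 < V α t := by
  have hN := h.neumannSol hα
  obtain ⟨z, z1, hz⟩ := hN.exists_linearized h.hk h.hlam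
  exact hN.deriv_pos_of_linearized_pos h.hk hz le_rfl
    (h.minimal_linearized_pos hα hlow hneg hz).1 hN.2.2.ge

/-- Without uniqueness, the minimal solution lies strictly below the odd one. -/
theorem minimal_lt_odd (h : ShootingFamily k lam U V) {α : ℝ} (hα : V α π = 0)
    (hlow : -(lam + 3) < α) (hneg : ∀ γ ∈ Ico (-(lam + 3)) α, V γ π < 0) {p q : ℝ → ℝ}
    (hp : OddSol k lam p q) (hne : ∃ u v, NeumannSol k lam u v ∧ u ≠ p) (t : ℝ) : U α t < p t := by
  obtain ⟨u, v, hu, hup⟩ := hne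
  refine (h.neumannSol hα).lt_of_le hp.sol (h.le_of_neumannSol hlow hneg hp.sol) (fun e => ?_) t
  refine hup (hp.eq_of_forall_le (fun u v hu => ?_) hu)
  rw [← e]
  exact h.le_of_neumannSol hlow hneg hu

/-- For large `k`, a minimal solution below the odd one is nonpositive. -/
theorem minimal_nonpos (h : ShootingFamily k lam U V) (hlam2 : lam ≤ 2) {ε : ℝ} (hε : 0 < ε)
    (hε0 : ε < 1 / 10 ^ 10) (hkε : k * ε ^ 2 = 1) {α : ℝ} (hα : V α π = 0)
    (hlow : -(lam + 3) < α) (hneg : ∀ γ ∈ Ico (-(lam + 3)) α, V γ π < 0) {p q : ℝ → ℝ}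
    (hp : OddSol k lam p q) (hlt : ∀ t, U α t < p t) : U α π ≤ 0 := by
  by_contra hb
  push Not at hb
  have hk := h.hk
  have hpi := pi_gt_three
  have hN := h.neumannSol hα
  obtain ⟨z, z1, hz⟩ := hN.exists_linearized h.hk h.hlam
  have hpos := h.minimal_linearized_pos hα hlow hneg hz
  have hv := h.minimal_deriv_pos hα hlow hneg
  have hk1 : 2304 ≤ k := by
    by_contra hlt
    push Not at hlt
    nlinarith
  have hmono : MonotoneOn (U α) (Icc 0 π) := monotoneOn_Icc_of_hasDerivAt (fun t _ => hN.1.1 t)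
    fun t ht => (hv t ht).le
  have h1 := hp.curvature_lower_bound hk1 h.hlam hlam2 hN hlt hmono hb rfl
  -- The choice η = ε/10 gives exactly k η² = 1/100, and 4η ≤ κ follows from κ > 1/2000.
  have h2 := hN.curvature_bound hk h.hlam hlam2 hz hpos.1 hpos.2 hv (η := ε / 10) (by linarith)
    (by norm_num at hε0 ⊢; linarith) (by nlinarith) rfl (by norm_num at hε0 ⊢; linarith)
  set κ := 1 - duffing lam (U α π)
  have h3 : κ ^ 2 * (k * ε) ≤ 1280 := by linarith
  have h4 : κ ^ 2 ≤ 1280 * ε := by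
    have := mul_le_mul_of_nonneg_right h3 hε.le
    rw [show κ ^ 2 * (k * ε) * ε = κ ^ 2 * (k * ε ^ 2) by ring, hkε, mul_one] at this
    exact this
  have h5 := pow_le_pow_left₀ (by norm_num) h1.le 2
  norm_num at h5 hε0
  linarith

/-- A strict nonpositive supersolution above the minimal solution makes it nondegenerate. -/
theorem minimal_strictly_stable (h : ShootingFamily k lam U V) {α : ℝ} (hα : V α π = 0)
    (hlow : -(lam + 3) < α) (hneg : ∀ γ ∈ Ico (-(lam + 3)) α, V γ π < 0) {σ σ1 σ2 : ℝ → ℝ}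
    (hσ : NegSupersol k lam σ σ1 σ2) {z z1 : ℝ → ℝ} (hz : Linearized k lam (U α) z z1) :
    0 < z1 π := by
  have hpi := pi_pos
  have hk := h.hk
  have hN := h.neumannSol hα
  obtain ⟨hpos, hπ⟩ := h.minimal_linearized_pos hα hlow hneg hz
  have hle := h.le_of_supersolution hlow hneg hσ.d1 hσ.d2 hσ.super hσ.bound hσ.left hσ.right
  -- Beyond the strict supersolution gap, the derivative contains k z (σ - U)²·(-(2U + σ)) ≥ 0, the
  -- concavity of the cubic on negative values. At π the Wronskian is z1 π (σ π - U α π).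
  have hW : StrictMonoOn (fun t => z1 t * (σ t - U α t) - z t * (σ1 t - V α t)) (Icc 0 π) := by
    refine strictMonoOn_Icc_of_hasDerivAt (fun t ht => ((hz.d2 t ht).fun_mul
      ((hσ.d1 t ht).fun_sub (hN.1.1 t))).fun_sub ((hz.d1 t ht).fun_mul
      ((hσ.d2 t ht).fun_sub (hN.1.2 t)))) fun t ht => ?_
    have ht' := Ioo_subset_Icc_self ht
    have h1 := mul_lt_mul_of_pos_left (hσ.strict t ht) (hpos t ht')
    have h2 := hle t ht'
    have h3 := hσ.nonpos t ht'
    have h4 : 0 ≤ z t * k * ((σ t - U α t) ^ 2 * -(2 * U α t + σ t)) :=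
      mul_nonneg (mul_nonneg (hpos t ht').le hk.le) (mul_nonneg (sq_nonneg _) (by linarith))
    unfold duffing at h1 ⊢
    linarith
  have := hW ⟨le_rfl, hpi.le⟩ ⟨hpi.le, le_rfl⟩ hpi
  simp only [hz.init_deriv, hσ.left, hσ.right, hN.2.1, hN.2.2, zero_mul, sub_self, mul_zero,
    sub_zero] at this
  exact pos_of_mul_pos_left this (sub_nonneg.2 (hle π ⟨hpi.le, le_rfl⟩))

/-- Existence of an intermediate solution between the minimal one and the odd one. -/
theorem exists_intermediate (h : ShootingFamily k lam U V) (hk : 2304 ≤ k) {α β : ℝ}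
    (hα : V α π = 0) (hβ : OddSol k lam (U β) (V β)) (hαβ : α < β) {z z1 : ℝ → ℝ}
    (hz : Linearized k lam (U α) z z1) (hz1 : 0 < z1 π) :
    ∃ γ, α < γ ∧ γ < β ∧ V γ π = 0 ∧ ∀ t ∈ Icc 0 π, U γ t < U β t := by
  have hpi := pi_pos
  have hcont := (h.continuous_apply ⟨hpi.le, le_rfl⟩).2
  obtain ⟨y, y1, hy⟩ := hβ.sol.exists_linearized h.hk h.hlam
  obtain ⟨hypos, hy1⟩ := hβ.strictly_stable hk h.hlam hy
  obtain ⟨η, hη, H⟩ := h.shooting_neg_left hβ.sol.2.2 hy hypos hy1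
  obtain ⟨θ, hθ, G⟩ := h.shooting_pos_right hα hz hz1
  obtain ⟨b, hb⟩ : ∃ b, b ∈ Ioo (max α (β - η)) β := nonempty_Ioo.2 (max_lt hαβ (by linarith))
  have hbα : α < b := (le_max_left _ _).trans_lt hb.1
  have hbη : β - η < b := (le_max_right _ _).trans_lt hb.1
  obtain ⟨a, ha⟩ : ∃ a, a ∈ Ioo α (min b (α + θ)) := nonempty_Ioo.2 (lt_min hbα (by linarith))
  have hab : a < b := ha.2.trans_le (min_le_left _ _)
  have hVa := G a ⟨ha.1, ha.2.trans_le (min_le_right _ _)⟩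
  have hVb := H b ⟨hbη, hb.2⟩
  obtain ⟨c, hc, hc0⟩ := intermediate_value_Icc' hab.le hcont.continuousOn ⟨hVb.1.le, hVa.le⟩
  have hcomp : IsCompact ({γ | V γ π = 0} ∩ Icc a b) :=
    isCompact_Icc.inter_left (isClosed_eq hcont continuous_const)
  -- Taking the greatest zero makes the shooting function negative on (γ, b], which is what excludes
  -- touching at π when sliding down from b to γ.
  obtain ⟨γ, ⟨hγ0, hγ⟩, hmax⟩ := hcomp.exists_isGreatest ⟨c, hc0, hc⟩
  have hγ0 : V γ π = 0 := hγ0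
  have hnegb : ∀ x ∈ Ioc γ b, V x π < 0 := fun x hx => by
    by_contra hge
    push Not at hge
    obtain ⟨y, hy, hy0⟩ := intermediate_value_Icc' hx.2 hcont.continuousOn ⟨hVb.1.le, hge⟩
    have := hmax ⟨hy0, by linarith [hγ.1, hx.1, hy.1], hy.2⟩
    linarith [hx.1, hy.1]
  refine ⟨γ, ha.1.trans_le hγ.1, hγ.2.trans_lt hb.2, hγ0, ?_⟩
  by_contra hcon
  push Not at hcon
  obtain ⟨t, ht, hle⟩ := hcon
  obtain ⟨C, hC, HC⟩ := h.lipschitz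
  obtain ⟨x, hx, hnn, s, hs, hs0⟩ := exists_touching (D := fun x t => U β t - U x t) (C := C)
    (α₀ := b) (α₁ := γ) hpi.le hC.le
    (fun x y t ht => by
      rw [show U β t - U x t - (U β t - U y t) = -(U x t - U y t) by ring, abs_neg]
      exact (HC x y t ht).1)
    (fun x => ((h.sol β).continuous.sub (h.sol x).continuous).continuousOn)
    (fun t ht => sub_pos.2 (hVb.2 t ht)) ⟨t, ht, sub_nonpos.2 hle⟩
  rw [uIcc_of_ge hγ.2] at hx
  have hd := fun t => ((h.sol β).1 t).sub ((h.sol x).1 t)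
  have hcrit : V β s - V x s = 0 := by
    rcases eq_or_lt_of_le hs.1 with e | hgt
    · rw [← e, h.init_deriv, h.init_deriv, sub_zero]
    · rcases eq_or_lt_of_le hs.2 with e | hlt
      · rw [e] at hs0 ⊢
        have h1 := deriv_nonpos_of_nonneg_left hpi (hd π) hs0 hnn
        rw [hβ.sol.2.2] at h1 ⊢
        rcases eq_or_lt_of_le hx.1 with e' | hlt'
        · rw [← e', hγ0, sub_zero]
        · linarith [hnegb x ⟨hlt', hx.2⟩]
      · exact deriv_eq_zero_of_nonneg_interior ⟨hgt, hlt⟩ (hd s) hs0 hnn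
  have := ((h.sol β).unique (truncDuffing_locallyLipschitz _ _) (h.sol x) (sub_eq_zero.1 hs0)
    (sub_eq_zero.1 hcrit) 0).1
  rw [h.init, h.init] at this
  linarith [hx.2, hb.2]

end ShootingFamily

/-! ### Assembly of the solutions and the threshold λ_b -/

/-- The five ordered solutions, given a strict nonpositive supersolution. -/
theorem exists_ordered_solutions {k lam : ℝ} (hk : 2304 ≤ k) (hlam : 0 ≤ lam) {σ σ1 σ2 : ℝ → ℝ}
    (hσ : NegSupersol k lam σ σ1 σ2) : ∃ u₁ v₁ u₂ v₂ p q, NeumannSol k lam u₁ v₁ ∧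
      NeumannSol k lam u₂ v₂ ∧ OddSol k lam p q ∧ ∀ t, u₁ t < u₂ t ∧ u₂ t < p t := by
  have hpi := pi_pos
  obtain ⟨U, V, h⟩ := exists_shootingFamily (by linarith : 0 < k) hlam
  obtain ⟨β, hβ⟩ := h.exists_oddSol
  obtain ⟨α, hα, hlow, hneg⟩ := h.exists_minimal hβ.sol.2.2
  have hN := h.neumannSol hα
  have hle := h.le_of_supersolution hlow hneg hσ.d1 hσ.d2 hσ.super hσ.bound hσ.left hσ.right
  have hne : U α ≠ U β := fun e => by
    have h1 := hle π ⟨hpi.le, le_rfl⟩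
    have h2 := hσ.nonpos π ⟨hpi.le, le_rfl⟩
    have h3 := hβ.pos_right
    rw [← e] at h3
    linarith
  have hlt := hN.lt_of_le hβ.sol (h.le_of_neumannSol hlow hneg hβ.sol) hne
  have hαβ : α < β := by simpa [h.init] using hlt 0
  obtain ⟨z, z1, hz⟩ := hN.exists_linearized h.hk h.hlam
  obtain ⟨γ, hαγ, hγβ, hγ, hγlt⟩ := h.exists_intermediate hk hα hβ hαβ hz
    (h.minimal_strictly_stable hα hlow hneg hσ hz)
  have hNγ := h.neumannSol hγ
  have ne_of_lt : ∀ x y, x < y → U x ≠ U y := fun x y hxy e => by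
    have := congrFun e 0
    rw [h.init, h.init] at this
    linarith
  exact ⟨_, _, _, _, _, _, hN, hNγ, hβ, fun t =>
    ⟨hN.lt_of_le hNγ (h.le_of_neumannSol hlow hneg hNγ) (ne_of_lt _ _ hαγ) t,
    hNγ.lt_of_le hβ.sol (fun s hs => (hγlt s hs).le) (ne_of_lt _ _ hγβ) t⟩⟩

theorem zero_mem_uniquenessSet {ε : ℝ} (hε : 0 < ε) : 0 ∈ uniquenessSet ε := by
  have hk : 0 < (ε ^ 2)⁻¹ := by positivity
  obtain ⟨U, V, h⟩ := exists_shootingFamily hk le_rfl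
  obtain ⟨β, hβ⟩ := h.exists_oddSol
  refine ⟨U β, hβ.isUp hε le_rfl, fun u => ⟨fun hu => ?_, fun e => ?_⟩⟩
  · obtain ⟨v, hv⟩ := (isNeumannSolution_iff hε).1 hu
    exact hβ.eq_of_lam_eq_zero hk hv
  · rw [e]
    exact (isNeumannSolution_iff hε).2 ⟨_, hβ.sol⟩

theorem not_mem_uniquenessSet_of_two_le {ε lam : ℝ} (hε : 0 < ε) (hk : 2304 ≤ (ε ^ 2)⁻¹)
    (hlam : 2 ≤ lam) : lam ∉ uniquenessSet ε := by
  rintro ⟨p, -, hp⟩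
  obtain ⟨σ, σ1, σ2, hσ⟩ := exists_negSupersol_const (by linarith : 0 < (ε ^ 2)⁻¹) hlam
  obtain ⟨u₁, v₁, u₂, v₂, _, _, h1, h2, _, hlt⟩ := exists_ordered_solutions hk (by linarith) hσ
  have e1 := (hp u₁).1 ((isNeumannSolution_iff hε).2 ⟨_, h1⟩)
  have e2 := (hp u₂).1 ((isNeumannSolution_iff hε).2 ⟨_, h2⟩)
  have := (hlt 0).1
  rw [e1, e2] at this
  exact lt_irrefl _ this

/-- Non-uniqueness at λ' separates the minimal solution from the odd one, hence makes it nonpositive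
and a supersolution for every larger λ. This is why uniqueness never returns. -/
theorem exists_negSupersol_of_not_mem {ε lam lam' : ℝ} (hε : 0 < ε) (hε0 : ε < 1 / 10 ^ 10)
    (hlam' : 0 ≤ lam') (hlam2 : lam' ≤ 2) (hlt : lam' < lam) (hmem : lam' ∉ uniquenessSet ε) :
    ∃ σ σ1 σ2, NegSupersol (ε ^ 2)⁻¹ lam σ σ1 σ2 := by
  have hk : 0 < (ε ^ 2)⁻¹ := by positivity
  obtain ⟨U, V, h⟩ := exists_shootingFamily hk hlam'
  obtain ⟨β, hβ⟩ := h.exists_oddSol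
  obtain ⟨α, hα, hlow, hneg⟩ := h.exists_minimal hβ.sol.2.2
  have hne : ∃ u v, NeumannSol (ε ^ 2)⁻¹ lam' u v ∧ u ≠ U β := by
    by_contra hcon
    push Not at hcon
    refine hmem ⟨U β, hβ.isUp hε hlam', fun u => ⟨fun hu => ?_, fun e => ?_⟩⟩
    · obtain ⟨v, hv⟩ := (isNeumannSolution_iff hε).1 hu
      exact hcon u v hv
    · rw [e]
      exact (isNeumannSolution_iff hε).2 ⟨_, hβ.sol⟩
  have hltβ := h.minimal_lt_odd hα hlow hneg hβ hne
  have hπ := h.minimal_nonpos hlam2 hε hε0 (inv_mul_cancel₀ (by positivity)) hα hlow hneg hβ hltβ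
  exact ⟨_, _, _, (h.neumannSol hα).negSupersol hk hlam' hlt
    (h.minimal_deriv_pos hα hlow hneg) hπ⟩

theorem mainTheorem5 :
    ∃ ε₀ : ℝ, 0 < ε₀ ∧ ∀ ε : ℝ, 0 < ε → ε < ε₀ →
      -- the number `λ_b` is a genuine supremum
      IsLUB (uniquenessSet ε) (lambdaB ε) ∧
      ∀ lam : ℝ, lambdaB ε < lam →
        (∃ u₁ u₂ u₃ u₄ u₅ : ℝ → ℝ,
          -- five `2π`-periodic solutions with `u'(0) = u'(π) = 0`
          (IsNeumannSolution ε lam u₁ ∧ Function.Periodic u₁ (2 * Real.pi)) ∧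
          (IsNeumannSolution ε lam u₂ ∧ Function.Periodic u₂ (2 * Real.pi)) ∧
          (IsNeumannSolution ε lam u₃ ∧ Function.Periodic u₃ (2 * Real.pi)) ∧
          (IsNeumannSolution ε lam u₄ ∧ Function.Periodic u₄ (2 * Real.pi)) ∧
          (IsNeumannSolution ε lam u₅ ∧ Function.Periodic u₅ (2 * Real.pi)) ∧
          -- negative initial values
          u₁ 0 < 0 ∧ u₂ 0 < 0 ∧ u₃ 0 < 0 ∧
          -- pointwise ordering
          (∀ t : ℝ, u₁ t < u₂ t ∧ u₂ t < u₃ t ∧ u₃ t < u₄ t ∧ u₄ t < u₅ t) ∧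
          -- `u₃` is the antisymmetric solution `u_p`
          IsUp ε lam u₃ ∧
          (∀ t : ℝ, u₃ (Real.pi / 2 + t) = -u₃ (Real.pi / 2 - t)) ∧
          -- the other solutions come in symmetric pairs
          (∀ t : ℝ, u₅ t = -u₁ (t + Real.pi)) ∧
          (∀ t : ℝ, u₄ t = -u₂ (t + Real.pi))) ∧
        -- no return to uniqueness
        lam ∉ uniquenessSet ε := by
  -- The size is dictated by 1280 ε < 1/2000² in the curvature contradiction; k ≥ 2304 is then
  -- automatic.
  refine ⟨1 / 10 ^ 10, by norm_num, fun ε hε hε0 => ?_⟩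
  have hpi := pi_pos
  have hk : 2304 ≤ (ε ^ 2)⁻¹ := by
    rw [le_inv_comm₀ (by norm_num) (by positivity)]
    have : ε ^ 2 ≤ (1 / 10 ^ 10) ^ 2 := pow_le_pow_left₀ hε.le hε0.le 2
    exact this.trans (by norm_num)
  have hbdd : BddAbove (uniquenessSet ε) := ⟨2, fun lam hlam => by
    by_contra hlt
    push Not at hlt
    exact not_mem_uniquenessSet_of_two_le hε hk hlt.le hlam⟩
  have hmem0 := zero_mem_uniquenessSet hε
  refine ⟨isLUB_csSup ⟨0, hmem0⟩ hbdd, fun lam hlam => ⟨?_, notMem_of_csSup_lt hlam hbdd⟩⟩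
  have hb0 : 0 ≤ lambdaB ε := le_csSup hbdd hmem0
  obtain ⟨σ, σ1, σ2, hσ⟩ : ∃ σ σ1 σ2, NegSupersol (ε ^ 2)⁻¹ lam σ σ1 σ2 := by
    rcases le_total 2 lam with h2 | h2
    · exact exists_negSupersol_const (by linarith) h2
    -- Any λ' above the supremum lies outside the uniqueness set; λ' < λ makes the supersolution
    -- strict.
    · obtain ⟨lam', h1, h3⟩ := exists_between hlam
      exact exists_negSupersol_of_not_mem hε hε0 (by linarith) (by linarith) h3
        (notMem_of_csSup_lt h1 hbdd)
  have hlam0 : 0 ≤ lam := by linarith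
  obtain ⟨u₁, v₁, u₂, v₂, p, q, h1, h2, hp, hlt⟩ := exists_ordered_solutions hk hlam0 hσ
  have conv : ∀ {u v : ℝ → ℝ}, NeumannSol (ε ^ 2)⁻¹ lam u v →
      IsNeumannSolution ε lam u ∧ Function.Periodic u (2 * π) := fun h =>
    ⟨(isNeumannSolution_iff hε).2 ⟨_, h⟩, h.periodic⟩
  have hp0 := hp.neg 0 ⟨le_rfl, by linarith⟩
  have hpS : ∀ t, -p (t + π) = p t := fun t => by
    rw [hp.sol.shift_eq, hp.odd, neg_neg]
  refine ⟨u₁, u₂, p, fun t => -u₂ (t + π), fun t => -u₁ (t + π), conv h1, conv h2, conv hp.sol,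
    conv h2.neg_shift, conv h1.neg_shift, by linarith [hlt 0], by linarith [hlt 0], hp0,
    fun t => ⟨(hlt t).1, (hlt t).2, ?_, ?_⟩, hp.isUp hε hlam0, fun t => ?_, fun _ => rfl,
    fun _ => rfl⟩
  · linarith [hpS t, (hlt (t + π)).2]
  · linarith [(hlt (t + π)).1]
  · rw [← hp.odd]
    congr 1
    ring
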